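/- Manifolds are finite-dimensional, smooth, Hausdorff, second countable, without boundary. Let $(G,M,s,t,e,i,m)$ be a Lie groupoid: $G$ (arrows) and $M$ (objects) are manifolds, $s,t:G\to M$ are submersions, all structure maps are smooth, and $m(g,h)$ is defined when $s(g)=t(h)$. Let $\omega$ be a multiplicative symplectic form on $G$, i.e. $m^*\omega=\mathrm{pr}_1^*\omega+\mathrm{pr}_2^*\omega$ on $G\times_{s,t}G$. Let $\pi$ be the Poisson structure on $M$ integrated by $(G,\omega)$: writing $\pi^\sharp:T^*M\to TM$, $\beta(\pi^\sharp\alpha)=\pi(\alpha,\beta)$, one has $\pi^\sharp\big(\omega(a,de_x\,\cdot)\big)=dt(a)$ for every $x\in M$ and every $a\in\ker ds_{e(x)}$ (that is, under the identification $a\mapsto\omega(a,de\,\cdot)$ of the Lie algebroid of $G$ with $T^*M$, the anchor is $\pi^\sharp$). **Proposition.** Let $F\subseteq M$ be an isomorphism class of objects, i.e. $F=t(s^{-1}(x_0))$ for some $x_0\in M$. Then $F$ is an injectively immersed submanifold of $M$ (with a Hausdorff, second countable manifold structure) whose tangent spaces are $T_yF=\pi^\sharp(T_y^*M)$, and it carries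 a unique $2$-form $\omega_F$ induced by $\pi$, i.e. such that $$\omega_F(\pi^\sharp\alpha,w)=\alpha(w)\qquad (y\in F,\ \alpha\in T_y^*M,\ w\in T_yF).$$ The form $\omega_F$ is symplectic, and the graph of the action $$\mathsf a=\{(g,x,y)\in G\times F\times F : s(g)=x,\ t(g)=y\}$$ is a Lagrangian submanifold (embedded, of half the dimension, with vanishing pullback of the form) of $\overline G\times\overline F\times F$, that is, of $G\times F\times F$ with the form $(-\omega)\oplus(-\omega_F)\oplus\omega_F$. -/

import Mathlib

open scoped Manifold ContDiff
open Manifold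

universe u

noncomputable section

/-! ### Differential 2-forms -/

section TwoForms

variable {E : Type*} [NormedAddCommGroup E] [NormedSpace ℝ E]
  {H : Type*} [TopologicalSpace H] (I : ModelWithCorners ℝ E H)
  (X : Type*) [TopologicalSpace X] [ChartedSpace H X]

/-- A (not necessarily smooth) field of alternating bilinear forms on the tangent spaces of `X`. -/
abbrev TwoForm : Type _ := ∀ x : X, (TangentSpace I x) [⋀^Fin 2]→L[ℝ] ℝ

variable {I X}

/-- The pullback `f^*Ω`, that is `(f^*Ω)_y (v, w) = Ω_{f y} (df v, df w)`. -/
def TwoForm.pullback {E' : Type*} [NormedAddCommGroup E'] [NormedSpace ℝ E']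
    {H' : Type*} [TopologicalSpace H'] (I' : ModelWithCorners ℝ E' H')
    {Y : Type*} [TopologicalSpace Y] [ChartedSpace H' Y]
    (Ω : TwoForm I X) (f : Y → X) : TwoForm I' Y :=
  fun y => (Ω (f y)).compContinuousLinearMap (mfderiv I' I f y)

/-- The expression of a 2-form in the chart at `x₀`: a 2-form on the model vector space,
meaningful on the target of the chart. -/
def TwoForm.inChart (Ω : TwoForm I X) (x₀ : X) : E → E [⋀^Fin 2]→L[ℝ] ℝ :=
  Ω.pullback 𝓘(ℝ, E) (extChartAt I x₀).symm

/-- A symplectic form (on a manifold without boundary): a 2-form that is smooth and closed in every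
chart, and nondegenerate at every point. -/
structure TwoForm.IsSymplectic (Ω : TwoForm I X) : Prop where
  smooth : ∀ x₀ : X, ContDiffOn ℝ ∞ (Ω.inChart x₀) (extChartAt I x₀).target
  closed : ∀ x₀ : X, ∀ y ∈ (extChartAt I x₀).target, extDeriv (Ω.inChart x₀) y = 0
  nondegenerate : ∀ (x : X) (v : TangentSpace I x),
    (∀ w : TangentSpace I x, Ω x ![v, w] = 0) → v = 0

/-- A Lagrangian submanifold of `(X, Ω)`: the subset `L`, with its subspace topology, is an embedded
smooth submanifold of half the dimension of `X`, and `Ω` pulls back to zero on it. -/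
def TwoForm.IsLagrangian (Ω : TwoForm I X) (L : Set X) : Prop :=
  ∃ (n : ℕ) (_ : ChartedSpace (EuclideanSpace ℝ (Fin n)) L),
    IsManifold (𝓡 n) ∞ L ∧
    IsSmoothEmbedding (𝓡 n) I ∞ (Subtype.val : L → X) ∧
    2 * n = Module.finrank ℝ E ∧
    Ω.pullback (𝓡 n) (Subtype.val : L → X) = 0

end TwoForms

/-! ### Poisson structures -/

section Poisson

variable {E : Type*} [NormedAddCommGroup E] [NormedSpace ℝ E]
  {H : Type*} [TopologicalSpace H] (I : ModelWithCorners ℝ E H)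
  (M : Type*) [TopologicalSpace M] [ChartedSpace H M]

/-- A (not necessarily smooth) bivector field, seen as a field of alternating bilinear forms on
the cotangent spaces. -/
abbrev BivectorField : Type _ := ∀ x : M, (TangentSpace I x →L[ℝ] ℝ) [⋀^Fin 2]→L[ℝ] ℝ

variable {I M}

/-- The bracket `{f, g} = π (df, dg)` of two functions. -/
def BivectorField.bracket (π : BivectorField I M) (f g : M → ℝ) : M → ℝ :=
  fun x => π x ![mfderiv I 𝓘(ℝ, ℝ) f x, mfderiv I 𝓘(ℝ, ℝ) g x]

/-- `π` is a Poisson structure: `{f, g} = π (df, dg)` sends smooth functions to smooth functions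
(that is, `π` is smooth) and satisfies the Jacobi identity. -/
structure BivectorField.IsPoisson (π : BivectorField I M) : Prop where
  smooth : ∀ f g : M → ℝ, ContMDiff I 𝓘(ℝ, ℝ) ∞ f → ContMDiff I 𝓘(ℝ, ℝ) ∞ g →
    ContMDiff I 𝓘(ℝ, ℝ) ∞ (π.bracket f g)
  jacobi : ∀ f g h : M → ℝ, ContMDiff I 𝓘(ℝ, ℝ) ∞ f → ContMDiff I 𝓘(ℝ, ℝ) ∞ g →
    ContMDiff I 𝓘(ℝ, ℝ) ∞ h → ∀ x : M,
      π.bracket f (π.bracket g h) x + π.bracket g (π.bracket h f) x +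
        π.bracket h (π.bracket f g) x = 0

/-- `v = π^♯ α`, where `π^♯ : T_x^*M → T_xM` is given by `β (π^♯ α) = π (α, β)`. -/
def BivectorField.IsSharp (π : BivectorField I M) {x : M}
    (α : TangentSpace I x →L[ℝ] ℝ) (v : TangentSpace I x) : Prop :=
  ∀ β : TangentSpace I x →L[ℝ] ℝ, β v = π x ![α, β]

/-- Let `ι : F → M` be an immersion. The 2-form `ΩF` on `F` is induced by `π` if the tangent spaces
of `F` are the images of `π^♯` and `ΩF` is the inverse of `π` on them:
`ΩF (π^♯ α, w) = α w` for `α ∈ T^*M` and `w ∈ TF`. -/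
structure BivectorField.Induces (π : BivectorField I M)
    {E' : Type*} [NormedAddCommGroup E'] [NormedSpace ℝ E']
    {H' : Type*} [TopologicalSpace H'] {I' : ModelWithCorners ℝ E' H'}
    {F : Type*} [TopologicalSpace F] [ChartedSpace H' F] (ι : F → M) (ΩF : TwoForm I' F) :
    Prop where
  tangent : ∀ (y : F) (u : TangentSpace I (ι y)),
    (∃ v : TangentSpace I' y, mfderiv I' I ι y v = u) ↔
      ∃ α : TangentSpace I (ι y) →L[ℝ] ℝ, π.IsSharp α u
  inverse : ∀ (y : F) (v : TangentSpace I' y) (α : TangentSpace I (ι y) →L[ℝ] ℝ),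
    π.IsSharp α (mfderiv I' I ι y v) →
      ∀ w : TangentSpace I' y, ΩF y ![v, w] = α (mfderiv I' I ι y w)

end Poisson

/-! ### Lie groupoids and symplectic groupoids -/

/-- A Lie groupoid with manifold of arrows `G` and manifold of objects `M`. The product `m g h`
(first `h`, then `g`) is meaningful for `s g = t h`; its values on other pairs play no role.
Smoothness on the fibre product `{(g, h) | s g = t h}`, an embedded submanifold of `G × G` as `s` is
a submersion, is smoothness on that subset of `G × G`. -/
structure LieGroupoid
    {EG : Type*} [NormedAddCommGroup EG] [NormedSpace ℝ EG]
    {HG : Type*} [TopologicalSpace HG] (IG : ModelWithCorners ℝ EG HG)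
    {EM : Type*} [NormedAddCommGroup EM] [NormedSpace ℝ EM]
    {HM : Type*} [TopologicalSpace HM] (IM : ModelWithCorners ℝ EM HM)
    (G : Type*) [TopologicalSpace G] [ChartedSpace HG G]
    (M : Type*) [TopologicalSpace M] [ChartedSpace HM M] where
  /-- source -/
  s : G → M
  /-- target -/
  t : G → M
  /-- identity arrows -/
  e : M → G
  /-- inversion -/
  i : G → G
  /-- composition -/
  m : G → G → G
  s_e : ∀ x, s (e x) = x
  t_e : ∀ x, t (e x) = x
  s_i : ∀ g, s (i g) = t g
  t_i : ∀ g, t (i g) = s g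
  s_m : ∀ g h, s g = t h → s (m g h) = s h
  t_m : ∀ g h, s g = t h → t (m g h) = t g
  m_assoc : ∀ g h k, s g = t h → s h = t k → m (m g h) k = m g (m h k)
  m_e : ∀ g, m g (e (s g)) = g
  e_m : ∀ g, m (e (t g)) g = g
  m_i : ∀ g, m g (i g) = e (t g)
  i_m : ∀ g, m (i g) g = e (s g)
  isSubmersion_s : IsSubmersion IG IM ∞ s
  isSubmersion_t : IsSubmersion IG IM ∞ t
  smooth_e : ContMDiff IM IG ∞ e
  smooth_i : ContMDiff IG IG ∞ i
  smooth_m : ContMDiffOn (IG.prod IG) IG ∞ (fun p : G × G => m p.1 p.2)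
    {p : G × G | s p.1 = t p.2}

namespace LieGroupoid

variable {EG : Type*} [NormedAddCommGroup EG] [NormedSpace ℝ EG]
  {HG : Type*} [TopologicalSpace HG] {IG : ModelWithCorners ℝ EG HG}
  {EM : Type*} [NormedAddCommGroup EM] [NormedSpace ℝ EM]
  {HM : Type*} [TopologicalSpace HM] {IM : ModelWithCorners ℝ EM HM}
  {G : Type*} [TopologicalSpace G] [ChartedSpace HG G]
  {M : Type*} [TopologicalSpace M] [ChartedSpace HM M]

/-- `S` is an isomorphism class of objects. -/
def IsIsoClass (Γ : LieGroupoid IG IM G M) (S : Set M) : Prop :=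
  ∃ x : M, S = {y | ∃ g : G, Γ.s g = x ∧ Γ.t g = y}

/-- `Ω` is multiplicative: `m^*Ω = pr₁^*Ω + pr₂^*Ω` on the fibre product `{(g, h) | s g = t h}`,
whose tangent space at `(g, h)` consists of the `(u, v)` with `ds u = dt v`. All derivatives `D` of
`m` along the fibre product agree on this tangent space. -/
def IsMultiplicative (Γ : LieGroupoid IG IM G M) (Ω : TwoForm IG G) : Prop :=
  ∀ g h : G, Γ.s g = Γ.t h →
    ∀ D : TangentSpace (IG.prod IG) (g, h) →L[ℝ] TangentSpace IG (Γ.m g h),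
      HasMFDerivWithinAt (IG.prod IG) IG (fun p : G × G => Γ.m p.1 p.2)
        {p : G × G | Γ.s p.1 = Γ.t p.2} (g, h) D →
      ∀ (u u' : TangentSpace IG g) (v v' : TangentSpace IG h),
        (mfderiv IG IM Γ.s g u : EM) = mfderiv IG IM Γ.t h v →
        (mfderiv IG IM Γ.s g u' : EM) = mfderiv IG IM Γ.t h v' →
        Ω (Γ.m g h) ![D (u, v), D (u', v')] = Ω g ![u, u'] + Ω h ![v, v']

/-- `(Γ, Ω)` is a symplectic groupoid. -/
structure IsSymplectic (Γ : LieGroupoid IG IM G M) (Ω : TwoForm IG G) : Prop where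
  isSymplectic : Ω.IsSymplectic
  isMultiplicative : Γ.IsMultiplicative Ω

/-- `(Γ, Ω)` integrates `π`: the fibre at `x` of the Lie algebroid of `Γ` is the kernel of `ds` at
the identity arrow `e x`, with anchor `dt`; under its identification with `T_x^*M` by
`a ↦ Ω (a, de ·)` the anchor has to become `π^♯`, i.e. `π^♯ (Ω (a, de ·)) = dt a`. This determines
`π`. (The analogous compatibility of the Lie algebroid brackets is not demanded.) -/
def Integrates (Γ : LieGroupoid IG IM G M) (Ω : TwoForm IG G) (π : BivectorField IM M) : Prop :=
  ∀ (x : M) (a : TangentSpace IG (Γ.e x)), mfderiv IG IM Γ.s (Γ.e x) a = 0 →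
    ∀ α : TangentSpace IM x →L[ℝ] ℝ,
      (∀ w : TangentSpace IM x, α w = Ω (Γ.e x) ![a, mfderiv IM IG Γ.e x w]) →
      π.IsSharp α (mfderiv IG IM Γ.t (Γ.e x) a : EM)

/-- The graph of the action on `F`, where `ι : F → M` is the inclusion:
the triples `(g, x, y)` with `s g = x` and `t g = y`. -/
def actionGraph (Γ : LieGroupoid IG IM G M) {F : Type*} (ι : F → M) : Set (G × F × F) :=
  {p | Γ.s p.1 = ι p.2.1 ∧ Γ.t p.1 = ι p.2.2}

end LieGroupoid

/-- The 2-form `(-ΩG) ⊕ (-ΩF) ⊕ ΩF` on `G × F × F`; this product with this form is written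
`Ḡ × F̄ × F`. -/
def actionForm
    {EG : Type*} [NormedAddCommGroup EG] [NormedSpace ℝ EG]
    {HG : Type*} [TopologicalSpace HG] {IG : ModelWithCorners ℝ EG HG}
    {EF : Type*} [NormedAddCommGroup EF] [NormedSpace ℝ EF]
    {HF : Type*} [TopologicalSpace HF] {IF : ModelWithCorners ℝ EF HF}
    {G : Type*} [TopologicalSpace G] [ChartedSpace HG G]
    {F : Type*} [TopologicalSpace F] [ChartedSpace HF F]
    (ΩG : TwoForm IG G) (ΩF : TwoForm IF F) :
    TwoForm (IG.prod (IF.prod IF)) (G × F × F) :=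
  -(TwoForm.pullback (IG.prod (IF.prod IF)) ΩG (fun p : G × F × F => p.1))
    - TwoForm.pullback (IG.prod (IF.prod IF)) ΩF (fun p : G × F × F => p.2.1)
    + TwoForm.pullback (IG.prod (IF.prod IF)) ΩF (fun p : G × F × F => p.2.2)

end

noncomputable section

set_option linter.unusedSectionVars false

section Flat
open Topology Set

variable {E : Type*} [NormedAddCommGroup E] [NormedSpace ℝ E]
  {E' : Type*} [NormedAddCommGroup E'] [NormedSpace ℝ E']

/-- The smooth inverse function theorem, on an open set. -/
theorem ContDiffOn.exists_openPartialHomeomorph [CompleteSpace E] {f : E → E'} {U : Set E}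
    (hU : IsOpen U) (hf : ContDiffOn ℝ ∞ f U) {a : E} (ha : a ∈ U) {f' : E ≃L[ℝ] E'}
    (hf' : HasFDerivAt f (f' : E →L[ℝ] E') a) :
    ∃ φ : OpenPartialHomeomorph E E', a ∈ φ.source ∧ φ.source ⊆ U ∧ (∀ x, φ x = f x) ∧
      ContDiffOn ℝ ∞ φ φ.source ∧ ContDiffOn ℝ ∞ φ.symm φ.target := by
  have hfa : ContDiffAt ℝ ∞ f a := hf.contDiffAt (hU.mem_nhds ha)
  let e := hfa.toOpenPartialHomeomorph f hf' (by simp)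
  have hcont : ContinuousOn (fderiv ℝ f) U := hf.continuousOn_fderiv_of_isOpen hU (by simp)
  have hS : IsOpen (U ∩ fderiv ℝ f ⁻¹' range ((↑) : (E ≃L[ℝ] E') → E →L[ℝ] E')) :=
    hcont.isOpen_inter_preimage hU ContinuousLinearEquiv.isOpen
  set S := U ∩ fderiv ℝ f ⁻¹' range ((↑) : (E ≃L[ℝ] E') → E →L[ℝ] E') with hSdef
  have hae : a ∈ e.source := hfa.mem_toOpenPartialHomeomorph_source hf' (by simp)
  have hcoe : ∀ x, e x = f x := fun x => rfl
  refine ⟨e.restrOpen S hS, ⟨hae, ha, f', hf'.fderiv.symm⟩, fun x hx => hx.2.1, fun x => rfl,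
    hf.mono fun x hx => hx.2.1, ?_⟩
  intro y hy
  have hy' : (e.restrOpen S hS).symm y ∈ e.source ∩ S := (e.restrOpen S hS).map_target hy
  obtain ⟨hxU, A, hA⟩ := hy'.2
  have hfx := hf.contDiffAt (hU.mem_nhds hxU)
  refine (OpenPartialHomeomorph.contDiffAt_symm (f₀' := A) _ hy ?_ hfx).contDiffWithinAt
  rw [hA]
  exact (hfx.differentiableAt (by simp)).hasFDerivAt

/-- The constant rank theorem. -/
theorem ContDiffOn.exists_constantRank [FiniteDimensional ℝ E] [FiniteDimensional ℝ E']
    {f : E → E'} {U : Set E} (hU : IsOpen U) (hf : ContDiffOn ℝ ∞ f U) {a : E} (ha : a ∈ U)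
    {r : ℕ} (hr : ∀ x ∈ U, Module.finrank ℝ (fderiv ℝ f x).range = r) :
    ∃ (U' : Set E) (V : Set (EuclideanSpace ℝ (Fin r))) (p : E' →L[ℝ] EuclideanSpace ℝ (Fin r))
      (σ : EuclideanSpace ℝ (Fin r) → E), IsOpen U' ∧ a ∈ U' ∧ U' ⊆ U ∧ IsOpen V ∧
      ContDiffOn ℝ ∞ σ V ∧ MapsTo σ V U' ∧
      (∀ x ∈ U', p (f x) ∈ V ∧ f (σ (p (f x))) = f x) ∧ ∀ v ∈ V, p (f (σ v)) = v := by
  set L := fderiv ℝ f a with hL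
  have hfa : HasFDerivAt f L a :=
    ((hf.contDiffAt (hU.mem_nhds ha)).differentiableAt (by simp)).hasFDerivAt
  let eR : L.range ≃L[ℝ] EuclideanSpace ℝ (Fin r) :=
    ContinuousLinearEquiv.ofFinrankEq (by rw [hr a ha, finrank_euclideanSpace_fin])
  obtain ⟨pl, hpl⟩ := LinearMap.exists_leftInverse_of_injective L.range.subtype
    (Submodule.ker_subtype _)
  obtain ⟨ql, hql⟩ := LinearMap.exists_leftInverse_of_injective L.ker.subtype
    (Submodule.ker_subtype _)
  let p : E' →L[ℝ] EuclideanSpace ℝ (Fin r) := (eR : _ →L[ℝ] _) ∘L pl.toContinuousLinearMap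
  let q : E →L[ℝ] L.ker := ql.toContinuousLinearMap
  have hpL : ∀ x, p (L x) = eR ⟨L x, x, rfl⟩ := fun x => by
    have := LinearMap.congr_fun hpl ⟨L x, x, rfl⟩
    simp only [LinearMap.comp_apply, Submodule.subtype_apply, LinearMap.id_apply] at this
    simp [p, this]
  have hq : ∀ x : L.ker, q x = x := fun x => by
    have := LinearMap.congr_fun hql x
    simpa [q] using this
  have hker : ∀ x, p (L x) = 0 → L x = 0 := fun x hx => by
    rw [hpL, map_eq_zero_iff eR eR.injective] at hx
    exact congrArg Subtype.val hx
  let T : E →L[ℝ] EuclideanSpace ℝ (Fin r) × L.ker := (p ∘L L).prod q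
  have hTinj : Function.Injective T := by
    rw [injective_iff_map_eq_zero]
    intro x hx
    have h1 : L x = 0 := hker x (congrArg Prod.fst hx)
    have h2 : q x = 0 := congrArg Prod.snd hx
    have h3 := hq ⟨x, h1⟩
    rw [h2] at h3
    exact congrArg Subtype.val h3.symm
  have hTsurj : Function.Surjective T := by
    rintro ⟨v, c⟩
    obtain ⟨⟨_, x, rfl⟩, hx⟩ := eR.surjective v
    refine ⟨x - q x + c, Prod.ext ?_ ?_⟩
    · have h1 : L (q x) = 0 := (q x).2
      have h2 : L c = 0 := c.2
      change p (L (x - q x + c)) = v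
      rw [map_add, map_sub, h1, h2, sub_zero, add_zero, hpL, ← hx]
      rfl
    · change q (x - q x + c) = c
      rw [map_add, map_sub, hq, hq, sub_self, zero_add]
  let T' : E ≃L[ℝ] EuclideanSpace ℝ (Fin r) × L.ker :=
    (LinearEquiv.ofBijective (T : E →ₗ[ℝ] _) ⟨hTinj, hTsurj⟩).toContinuousLinearEquiv
  have hΘ : ContDiffOn ℝ ∞ (fun x => (p (f x), q x)) U :=
    (p.contDiff.comp_contDiffOn hf).prodMk q.contDiff.contDiffOn
  have hΘ' : HasFDerivAt (fun x => (p (f x), q x)) (T' : E →L[ℝ] _) a :=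
    (p.hasFDerivAt.comp a hfa).prodMk q.hasFDerivAt
  obtain ⟨e, hae, heU, hecoe, -, hes⟩ := hΘ.exists_openPartialHomeomorph hU ha hΘ'
  obtain ⟨δ, hδ, hball⟩ := Metric.isOpen_iff.1 e.open_target (e a) (e.map_source hae)
  rcases hb : e a with ⟨b₁, b₂⟩
  rw [hb, ← ball_prod_same] at hball
  have hpe : ∀ z ∈ e.target, p (f (e.symm z)) = z.1 := fun z hz => by
    have := e.right_inv hz
    rw [hecoe] at this
    exact congrArg Prod.fst this
  have hconst : ∀ v ∈ Metric.ball b₁ δ, ∀ c ∈ Metric.ball b₂ δ, ∀ c' ∈ Metric.ball b₂ δ,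
      f (e.symm (v, c)) = f (e.symm (v, c')) := by
    intro v hv c hc c' hc'
    have hder : ∀ c ∈ Metric.ball b₂ δ,
        HasFDerivAt (fun c => f (e.symm (v, c))) (0 : L.ker →L[ℝ] E') c := by
      intro c hc
      have hz : (v, c) ∈ e.target := hball ⟨hv, hc⟩
      have hu : e.symm (v, c) ∈ U := heU (e.map_target hz)
      have hD : HasFDerivAt e.symm (fderiv ℝ e.symm (v, c)) (v, c) :=
        ((hes.contDiffAt (e.open_target.mem_nhds hz)).differentiableAt (by simp)).hasFDerivAt
      have hfu : HasFDerivAt f (fderiv ℝ f (e.symm (v, c))) (e.symm (v, c)) :=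
        ((hf.contDiffAt (hU.mem_nhds hu)).differentiableAt (by simp)).hasFDerivAt
      set D := fderiv ℝ e.symm (v, c)
      set A := fderiv ℝ f (e.symm (v, c)) with hA
      have hpAD : p ∘L A ∘L D = ContinuousLinearMap.fst ℝ _ _ := by
        refine (p.hasFDerivAt.comp (v, c) (hfu.comp (v, c) hD)).unique ?_
        refine hasFDerivAt_fst.congr_of_eventuallyEq ?_
        filter_upwards [e.open_target.mem_nhds hz] with z hz using hpe z hz
      have hinj : Function.Injective (p.toLinearMap.domRestrict A.range) := by
        rw [LinearMap.injective_iff_surjective_of_finrank_eq_finrank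
          (by rw [hr _ hu, finrank_euclideanSpace_fin])]
        intro w
        exact ⟨⟨A (D (w, 0)), _, rfl⟩, DFunLike.congr_fun hpAD (w, 0)⟩
      have hzero : A ∘L D ∘L ContinuousLinearMap.inr ℝ _ _ = 0 := by
        ext w
        have h0 : p.toLinearMap.domRestrict A.range ⟨A (D (0, w)), _, rfl⟩ = 0 :=
          DFunLike.congr_fun hpAD (0, w)
        rw [map_eq_zero_iff _ hinj] at h0
        exact congrArg Subtype.val h0
      rw [← hzero]
      have h2 : HasFDerivAt (fun c => e.symm (v, c)) (D ∘L ContinuousLinearMap.inr ℝ _ _) c :=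
        hD.comp c (hasFDerivAt_prodMk_right v c)
      exact HasFDerivAt.comp (g := f) c hfu h2
    refine (convex_ball b₂ δ).is_const_of_fderivWithin_eq_zero (𝕜 := ℝ)
      (fun c hc => (hder c hc).differentiableAt.differentiableWithinAt) (fun c hc => ?_) hc hc'
    rw [fderivWithin_of_isOpen Metric.isOpen_ball hc]
    exact (hder c hc).fderiv
  have hb₂ : b₂ ∈ Metric.ball b₂ δ := Metric.mem_ball_self hδ
  have hmem : ∀ v ∈ Metric.ball b₁ δ, (v, b₂) ∈ e.target := fun v hv => hball (mk_mem_prod hv hb₂)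
  clear_value T' p q
  refine ⟨e.source ∩ e ⁻¹' (Metric.ball b₁ δ ×ˢ Metric.ball b₂ δ), Metric.ball b₁ δ, p,
    fun v => e.symm (v, b₂), ?_, ⟨hae, ?_⟩, fun x hx => heU hx.1, Metric.isOpen_ball, ?_,
    fun v hv => ⟨e.map_target (hmem v hv), ?_⟩, fun x hx => ?_, fun v hv => ?_⟩
  · exact e.isOpen_inter_preimage (Metric.isOpen_ball.prod Metric.isOpen_ball)
  · rw [mem_preimage, hb]
    exact mk_mem_prod (Metric.mem_ball_self hδ) hb₂
  · exact hes.comp (contDiff_id.prodMk contDiff_const).contDiffOn hmem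
  · rw [mem_preimage, e.right_inv (hmem v hv)]
    exact mk_mem_prod hv hb₂
  · obtain ⟨hxe, hx₁, hx₂⟩ := hx
    have h1 : p (f x) = (e x).1 := by rw [hecoe]
    have h2 := hconst _ hx₁ _ hb₂ _ hx₂
    rw [Prod.mk.eta, e.left_inv hxe] at h2
    rw [h1]
    exact ⟨hx₁, h2⟩
  · exact hpe _ (hmem v hv)

end Flat

section Slice
open Topology Set

/-- An immersion of vector spaces becomes linear after a change of coordinates in the target. -/
theorem ContDiffOn.exists_straightening
    {E₁ : Type*} [NormedAddCommGroup E₁] [NormedSpace ℝ E₁] [FiniteDimensional ℝ E₁]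
    {E : Type*} [NormedAddCommGroup E] [NormedSpace ℝ E] [FiniteDimensional ℝ E]
    (C : Type*) [NormedAddCommGroup C] [NormedSpace ℝ C] [FiniteDimensional ℝ C]
    {A : E₁ → E} {V : Set E₁} (hV : IsOpen V) (hA : ContDiffOn ℝ ∞ A V) {a : E₁} (ha : a ∈ V)
    (hinj : Function.Injective (fderiv ℝ A a))
    (hdim : Module.finrank ℝ E₁ + Module.finrank ℝ C = Module.finrank ℝ E) :
    ∃ (L : (E₁ × C) ≃L[ℝ] E) (e : OpenPartialHomeomorph E E), L (a, 0) ∈ e.source ∧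
      ContDiffOn ℝ ∞ e e.source ∧ ContDiffOn ℝ ∞ e.symm e.target ∧
      ∀ u, L (u, 0) ∈ e.source → u ∈ V ∧ e (L (u, 0)) = A u := by
  set D := fderiv ℝ A a with hD
  have hDA : HasFDerivAt A D a :=
    ((hA.contDiffAt (hV.mem_nhds ha)).differentiableAt (by simp)).hasFDerivAt
  obtain ⟨K, hK⟩ := Submodule.exists_isCompl (LinearMap.range D.toLinearMap)
  have hrange : Module.finrank ℝ (LinearMap.range D.toLinearMap) = Module.finrank ℝ E₁ :=
    LinearMap.finrank_range_of_inj hinj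
  have hKdim : Module.finrank ℝ C = Module.finrank ℝ K := by
    have := Submodule.finrank_add_eq_of_isCompl hK
    omega
  let eK : C ≃ₗ[ℝ] K := LinearEquiv.ofFinrankEq _ _ hKdim
  let L : (E₁ × C) ≃L[ℝ] E :=
    (((LinearEquiv.ofInjective D.toLinearMap hinj).prodCongr eK).trans
      (Submodule.prodEquivOfIsCompl _ _ hK)).toContinuousLinearEquiv
  have hL : ∀ u c, L (u, c) = D u + eK c := fun u c => rfl
  clear_value L
  let f : E → E := fun z => A (L.symm z).1 + L (0, (L.symm z).2)
  let U : Set E := (fun z => (L.symm z).1) ⁻¹' V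
  have hfst : ContDiff ℝ ∞ (fun z => (L.symm z).1) := contDiff_fst.comp L.symm.contDiff
  have hU : IsOpen U := hV.preimage hfst.continuous
  have hf : ContDiffOn ℝ ∞ f U :=
    (hA.comp hfst.contDiffOn fun z hz => hz).add (L.contDiff.comp
      (contDiff_const.prodMk (contDiff_snd.comp L.symm.contDiff))).contDiffOn
  have h0 : (L.symm (L (a, 0))).1 = a := by simp
  have hf' : HasFDerivAt f ((ContinuousLinearEquiv.refl ℝ E : E ≃L[ℝ] E) : E →L[ℝ] E)
      (L (a, 0)) := by
    have h1 : HasFDerivAt (fun z => (L.symm z).1)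
        (ContinuousLinearMap.fst ℝ E₁ C ∘L (L.symm : E →L[ℝ] E₁ × C)) (L (a, 0)) :=
      ((ContinuousLinearMap.fst ℝ E₁ C) ∘L (L.symm : E →L[ℝ] E₁ × C)).hasFDerivAt
    have h2 : HasFDerivAt (fun z => A (L.symm z).1)
        (D ∘L ContinuousLinearMap.fst ℝ E₁ C ∘L (L.symm : E →L[ℝ] E₁ × C)) (L (a, 0)) :=
      HasFDerivAt.comp (g := A) (L (a, 0)) (by rw [h0]; exact hDA) h1
    have h3 := ((L : E₁ × C →L[ℝ] E) ∘L ContinuousLinearMap.inr ℝ E₁ C ∘L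
      ContinuousLinearMap.snd ℝ E₁ C ∘L (L.symm : E →L[ℝ] E₁ × C)).hasFDerivAt (x := L (a, 0))
    refine (h2.add h3).congr_fderiv ?_
    refine ContinuousLinearMap.ext fun z => ?_
    obtain ⟨⟨u, c⟩, rfl⟩ := L.surjective z
    change D (L.symm (L (u, c))).1 + L (0, (L.symm (L (u, c))).2) = L (u, c)
    rw [L.symm_apply_apply, hL, hL, map_zero, zero_add]
  obtain ⟨e, he, heU, hcoe, hes, hes'⟩ :=
    hf.exists_openPartialHomeomorph hU (show (L.symm (L (a, 0))).1 ∈ V by rwa [h0]) hf'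
  refine ⟨L, e, he, hes, hes', fun u hu => ⟨?_, ?_⟩⟩
  · have := heU hu
    simpa [U] using this
  · have h00 : L (0, 0) = 0 := map_zero L
    rw [hcoe]
    simp [f, h00]

variable {E : Type*} [NormedAddCommGroup E] [NormedSpace ℝ E]
  {H : Type*} [TopologicalSpace H] (I : ModelWithCorners ℝ E H)
  {X : Type*} [TopologicalSpace X] [ChartedSpace H X]
  {F : Type*} [TopologicalSpace F] {k : ℕ}

/-- The charted space structure with given preferred charts. -/
abbrev chartedSpaceOfCharts {H : Type*} [TopologicalSpace H] (φ : F → OpenPartialHomeomorph F H)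
    (hφ : ∀ y, y ∈ (φ y).source) : ChartedSpace H F where
  atlas := range φ
  chartAt := φ
  mem_chart_source := hφ
  chart_mem_atlas y := ⟨y, rfl⟩

/-- A chart `φ` of `F` is a slice chart for `ι : F → X` if it is the restriction along `ι` of
a smooth map on an open subset of `X`, and `ι` is smooth in this chart. -/
def IsSliceChart (ι : F → X) (φ : OpenPartialHomeomorph F (EuclideanSpace ℝ (Fin k))) : Prop :=
  ContMDiffOn (𝓡 k) I ∞ (ι ∘ φ.symm) φ.target ∧
  ∃ (q : X → EuclideanSpace ℝ (Fin k)) (O : Set X), IsOpen O ∧ ContMDiffOn I (𝓡 k) ∞ q O ∧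
    ∀ z ∈ φ.source, ι z ∈ O ∧ q (ι z) = φ z

variable {I}

theorem isManifold_of_isSliceChart {ι : F → X}
    {φ : F → OpenPartialHomeomorph F (EuclideanSpace ℝ (Fin k))} (hφ : ∀ y, y ∈ (φ y).source)
    (h : ∀ y, IsSliceChart I ι (φ y)) :
    letI := chartedSpaceOfCharts φ hφ
    IsManifold (𝓡 k) ∞ F := by
  let _ := chartedSpaceOfCharts φ hφ
  refine isManifold_of_contDiffOn _ _ _ ?_
  rintro _ _ ⟨y, rfl⟩ ⟨y', rfl⟩
  obtain ⟨hι, -⟩ := h y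
  obtain ⟨-, q, O, hO, hq, hqφ⟩ := h y'
  rw [← contMDiffOn_iff_contDiffOn]
  have h1 : ContMDiffOn (𝓡 k) (𝓡 k) ∞ (q ∘ (ι ∘ (φ y).symm)) ((φ y).symm ≫ₕ φ y').source := by
    refine hq.comp (hι.mono fun u hu => ?_) fun u hu => ?_
    · simp only [mfld_simps] at hu
      exact hu.1
    · simp only [mfld_simps] at hu
      exact (hqφ _ hu.2).1
  refine (h1.congr fun u hu => ?_).mono fun u hu => ?_
  · simp only [mfld_simps] at hu
    simp only [mfld_simps]
    exact ((hqφ _ hu.2).2).symm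
  · simpa only [mfld_simps] using hu

theorem isImmersion_of_isSliceChart [FiniteDimensional ℝ E] [I.Boundaryless]
    [IsManifold I ∞ X] {ι : F → X} (hι : Continuous ι)
    {φ : F → OpenPartialHomeomorph F (EuclideanSpace ℝ (Fin k))} (hφ : ∀ y, y ∈ (φ y).source)
    (h : ∀ y, IsSliceChart I ι (φ y)) :
    letI := chartedSpaceOfCharts φ hφ
    IsImmersion (𝓡 k) I ∞ ι := by
  let _ := chartedSpaceOfCharts φ hφ
  have : IsManifold (𝓡 k) ∞ F := isManifold_of_isSliceChart hφ h
  refine IsImmersionOfComplement.isImmersion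
    (F := EuclideanSpace ℝ (Fin (Module.finrank ℝ E - k))) fun y => ?_
  obtain ⟨hιφ, q, O, hO, hq, hqφ⟩ := h y
  set χ := chartAt H (ι y)
  let A : EuclideanSpace ℝ (Fin k) → E := fun u => I (χ (ι ((φ y).symm u)))
  let V : Set (EuclideanSpace ℝ (Fin k)) := (φ y).target ∩ (φ y).symm ⁻¹' (ι ⁻¹' χ.source)
  have hV : IsOpen V := (φ y).isOpen_inter_preimage_symm (χ.open_source.preimage hι)
  have ha : φ y y ∈ V := ⟨(φ y).map_source (hφ y), by
    rw [mem_preimage, (φ y).left_inv (hφ y)]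
    exact mem_chart_source H (ι y)⟩
  have hA : ContDiffOn ℝ ∞ A V := by
    rw [← contMDiffOn_iff_contDiffOn]
    exact (I.contMDiff.comp_contMDiffOn contMDiffOn_chart).comp
      (hιφ.mono inter_subset_left) fun u hu => hu.2
  have hleft : ∀ᶠ u in 𝓝 (φ y y), q (χ.symm (I.symm (A u))) = u := by
    filter_upwards [hV.mem_nhds ha] with u hu
    simp only [A, I.left_inv]
    rw [χ.left_inv hu.2, (hqφ _ ((φ y).map_target hu.1)).2, (φ y).right_inv hu.1]
  have hinj : Function.Injective (fderiv ℝ A (φ y y)) := by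
    have hB : ContMDiffAt 𝓘(ℝ, E) (𝓡 k) ∞ (fun z => q (χ.symm (I.symm z))) (A (φ y y)) := by
      have h1 : ContMDiffAt 𝓘(ℝ, E) I ∞ (fun z => χ.symm (I.symm z)) (A (φ y y)) := by
        refine ContMDiffAt.comp (g := χ.symm) (A (φ y y))
          (contMDiffAt_symm_of_mem_maximalAtlas (IsManifold.chart_mem_maximalAtlas (ι y)) ?_) ?_
        · simp only [A, I.left_inv]
          exact χ.map_source ha.2
        · refine (I.contMDiffOn_symm).contMDiffAt ?_
          rw [I.range_eq_univ]
          exact Filter.univ_mem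
      refine ContMDiffAt.comp (g := q) (A (φ y y)) (hq.contMDiffAt (hO.mem_nhds ?_)) h1
      simp only [A, I.left_inv]
      rw [χ.left_inv ha.2, (φ y).left_inv (hφ y)]
      exact (hqφ _ (hφ y)).1
    have hB' := ((contMDiffAt_iff_contDiffAt.1 hB).differentiableAt (by simp)).hasFDerivAt
    have hA' := ((hA.contDiffAt (hV.mem_nhds ha)).differentiableAt (by simp)).hasFDerivAt
    have hid := (hB'.comp (φ y y) hA').unique ((hasFDerivAt_id _).congr_of_eventuallyEq hleft)
    intro u u' huu'
    have := congrArg (fderiv ℝ (fun z => q (χ.symm (I.symm z))) (A (φ y y))) huu'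
    have h1 := DFunLike.congr_fun hid u
    have h2 := DFunLike.congr_fun hid u'
    simp only [ContinuousLinearMap.comp_apply, ContinuousLinearMap.id_apply] at h1 h2
    rw [← h1, ← h2, this]
  have hdim : Module.finrank ℝ (EuclideanSpace ℝ (Fin k)) +
      Module.finrank ℝ (EuclideanSpace ℝ (Fin (Module.finrank ℝ E - k))) =
        Module.finrank ℝ E := by
    have := LinearMap.finrank_le_finrank_of_injective (f := (fderiv ℝ A (φ y y)).toLinearMap) hinj
    rw [finrank_euclideanSpace_fin] at this
    rw [finrank_euclideanSpace_fin, finrank_euclideanSpace_fin]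
    omega
  obtain ⟨L, e, he, hes, hes', heA⟩ := hA.exists_straightening
    (EuclideanSpace ℝ (Fin (Module.finrank ℝ E - k))) hV ha hinj hdim
  let J : OpenPartialHomeomorph H E := I.toHomeomorph.toOpenPartialHomeomorph
  let ψ : OpenPartialHomeomorph X H := χ ≫ₕ J ≫ₕ e.symm ≫ₕ J.symm
  have hψs : ∀ x, x ∈ ψ.source ↔ x ∈ χ.source ∧ I (χ x) ∈ e.target := fun x => by
    simp [ψ, J, ModelWithCorners.toHomeomorph]
  have hψt : ∀ x, x ∈ ψ.target ↔ I x ∈ e.source ∧ I.symm (e (I x)) ∈ χ.target := fun x => by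
    simp [ψ, J, ModelWithCorners.toHomeomorph]
  have hIs : ContMDiff 𝓘(ℝ, E) I ∞ I.symm := by
    rw [← contMDiffOn_univ, ← I.range_eq_univ]
    exact I.contMDiffOn_symm
  have hψ : ψ ∈ IsManifold.maximalAtlas I ∞ X := by
    refine ψ.mem_maximalAtlas_of_contMDiffOn ?_ ?_
    · refine hIs.comp_contMDiffOn ((contMDiffOn_iff_contDiffOn.2 hes').comp
        ((I.contMDiff.comp_contMDiffOn (contMDiffOn_chart (x := ι y))).mono ?_) ?_)
      · exact fun x hx => ((hψs x).1 hx).1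
      · exact fun x hx => ((hψs x).1 hx).2
    · refine (contMDiffOn_chart_symm (x := ι y)).comp (hIs.comp_contMDiffOn
        ((contMDiffOn_iff_contDiffOn.2 hes).comp I.contMDiff.contMDiffOn ?_)) ?_
      · exact fun x hx => ((hψt x).1 hx).1
      · exact fun x hx => ((hψt x).1 hx).2
  let S : Set (EuclideanSpace ℝ (Fin k)) := (fun u => L (u, 0)) ⁻¹' e.source
  have hS : IsOpen S := e.open_source.preimage (by fun_prop)
  have hT : IsOpen ((φ y).source ∩ φ y ⁻¹' S) := (φ y).isOpen_inter_preimage hS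
  refine IsImmersionAtOfComplement.mk_of_continuousAt hι.continuousAt L
    ((φ y).restr ((φ y).source ∩ φ y ⁻¹' S)) ψ ?_ ?_ ?_ hψ ?_
  · rw [OpenPartialHomeomorph.restr_source, hT.interior_eq]
    exact ⟨hφ y, hφ y, he⟩
  · rw [hψs]
    refine ⟨mem_chart_source H (ι y), ?_⟩
    have h1 := (heA _ he).2
    simp only [A, (φ y).left_inv (hφ y)] at h1
    rw [← h1]
    exact e.map_source he
  · exact restr_mem_maximalAtlas _ (IsManifold.chart_mem_maximalAtlas y) hT
  · intro u hu
    have hu' : u ∈ (φ y).target ∧ L (u, 0) ∈ e.source := by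
      simp only [hT.interior_eq, mfld_simps] at hu
      refine ⟨hu.1, ?_⟩
      have := hu.2.2
      rwa [(φ y).right_inv hu.1] at this
    have h1 := heA u hu'.2
    change I (I.symm (e.symm (I (χ (ι ((φ y).symm u)))))) = L (u, 0)
    rw [I.right_inv (by rw [I.range_eq_univ]; trivial)]
    change e.symm (A u) = _
    rw [← h1.2, e.left_inv hu'.2]

end Slice

section Pullback
open Topology Set

variable {E₁ : Type*} [NormedAddCommGroup E₁] [NormedSpace ℝ E₁]
  {E₂ : Type*} [NormedAddCommGroup E₂] [NormedSpace ℝ E₂]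

variable (E₁) in
/-- Antisymmetrisation of bilinear forms. -/
def antisymm₂ : ContinuousMultilinearMap ℝ (fun _ : Fin 2 => E₁) ℝ →L[ℝ] E₁ [⋀^Fin 2]→L[ℝ] ℝ :=
  ContinuousAlternatingMap.liftCLM
    (ContinuousLinearMap.id ℝ _ - ((ContinuousMultilinearMap.domDomCongrₗᵢ ℝ E₁ ℝ
      (Equiv.swap (0 : Fin 2) 1)).toContinuousLinearEquiv : _ →L[ℝ] _)) (by
    intro f v i j hv hij
    have h01 : v 0 = v 1 := by
      fin_cases i <;> fin_cases j <;> simp_all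
    have hswap : (fun i => v (Equiv.swap (0 : Fin 2) 1 i)) = v := by
      funext i
      fin_cases i <;> simp [h01]
    change f v - f (fun i => v (Equiv.swap (0 : Fin 2) 1 i)) = 0
    rw [hswap, sub_self])

theorem antisymm₂_coe (f : E₁ [⋀^Fin 2]→L[ℝ] ℝ) :
    antisymm₂ E₁ f.toContinuousMultilinearMap = (2 : ℝ) • f := by
  ext v
  change f v - f (v ∘ Equiv.swap (0 : Fin 2) 1) = 2 * f v
  have h : f (v ∘ Equiv.swap (0 : Fin 2) 1) = -f v :=
    f.toAlternatingMap.map_swap v (by decide)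
  rw [h]
  ring

theorem contDiff_compContinuousLinearMap₂ {n : WithTop ℕ∞} :
    ContDiff ℝ n fun p : (E₂ [⋀^Fin 2]→L[ℝ] ℝ) × (E₁ →L[ℝ] E₂) =>
      p.1.compContinuousLinearMap p.2 := by
  have h : (fun p : (E₂ [⋀^Fin 2]→L[ℝ] ℝ) × (E₁ →L[ℝ] E₂) => p.1.compContinuousLinearMap p.2) =
      fun p => (2⁻¹ : ℝ) • antisymm₂ E₁
        (ContinuousMultilinearMap.compContinuousLinearMapContinuousMultilinear ℝ
          (fun _ : Fin 2 => E₁) (fun _ => E₂) ℝ (fun _ => p.2)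
          (ContinuousAlternatingMap.toContinuousMultilinearMapCLM ℝ p.1)) := by
    funext p
    have := antisymm₂_coe (p.1.compContinuousLinearMap p.2)
    rw [eq_inv_smul_iff₀ two_ne_zero, ← this]
    rfl
  rw [h]
  refine ContDiff.const_smul (2⁻¹ : ℝ) (ContDiff.comp (antisymm₂ E₁).contDiff
    (ContDiff.clm_apply ?_ ?_))
  · have h2 : ContDiff ℝ n fun (p : (E₂ [⋀^Fin 2]→L[ℝ] ℝ) × (E₁ →L[ℝ] E₂)) (_ : Fin 2) => p.2 :=
      contDiff_pi.2 fun _ => contDiff_snd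
    exact (ContinuousMultilinearMap.contDiff _).comp h2
  · exact (ContinuousAlternatingMap.toContinuousMultilinearMapLI (𝕜 := ℝ) (E := E₂) (F := ℝ)
      (ι := Fin 2)).contDiff.comp contDiff_fst

variable {E : Type*} [NormedAddCommGroup E] [NormedSpace ℝ E]
  {H : Type*} [TopologicalSpace H] {I : ModelWithCorners ℝ E H} [I.Boundaryless]
  {X : Type*} [TopologicalSpace X] [ChartedSpace H X] [IsManifold I ∞ X]

/-- The pullback of a 2-form to a vector space, as a function. -/
def TwoForm.pullbackVec (Ω : TwoForm I X) (σ : E₁ → X) : E₁ → E₁ [⋀^Fin 2]→L[ℝ] ℝ :=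
  Ω.pullback 𝓘(ℝ, E₁) σ

/-- Near a point, the pullback of a 2-form to a vector space is the pullback of its expression
in a chart. -/
theorem TwoForm.pullback_eventuallyEq (Ω : TwoForm I X) {V : Set E₁} (hV : IsOpen V)
    {σ : E₁ → X} (hσ : ContMDiffOn 𝓘(ℝ, E₁) I ∞ σ V) {v₀ : E₁} (hv₀ : v₀ ∈ V) :
    ∃ A : E₁ → E, ContDiffAt ℝ ∞ A v₀ ∧ A v₀ ∈ (extChartAt I (σ v₀)).target ∧
      (Ω.pullbackVec σ) =ᶠ[𝓝 v₀]
        fun v => (Ω.inChart (σ v₀) (A v)).compContinuousLinearMap (fderiv ℝ A v) := by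
  set χ := extChartAt I (σ v₀) with hχ
  have hσ₀ : ContMDiffAt 𝓘(ℝ, E₁) I ∞ σ v₀ := hσ.contMDiffAt (hV.mem_nhds hv₀)
  have hU : σ ⁻¹' χ.source ∈ 𝓝 v₀ :=
    hσ₀.continuousAt.preimage_mem_nhds (extChartAt_source_mem_nhds (σ v₀))
  refine ⟨fun v => χ (σ v), ?_, χ.map_source (mem_extChartAt_source _), ?_⟩
  · rw [← contMDiffAt_iff_contDiffAt]
    exact contMDiffAt_extChartAt.comp v₀ hσ₀
  · filter_upwards [hV.mem_nhds hv₀, hU,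
      eventually_mem_nhds_iff.2 hU] with v hv hvs hvn
    have hσv : ContMDiffAt 𝓘(ℝ, E₁) I ∞ σ v := hσ.contMDiffAt (hV.mem_nhds hv)
    have h1 : MDifferentiableAt 𝓘(ℝ, E₁) 𝓘(ℝ, E) (fun v => χ (σ v)) v := by
      refine ContMDiffAt.mdifferentiableAt (n := ∞) ?_ (by simp)
      refine ContMDiffAt.comp (g := χ) v (contMDiffAt_extChartAt' ?_) hσv
      rwa [mem_preimage, hχ, extChartAt_source] at hvs
    have h2 : MDifferentiableAt 𝓘(ℝ, E) I χ.symm (χ (σ v)) := by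
      refine ContMDiffAt.mdifferentiableAt (n := ∞) ?_ (by simp)
      exact (contMDiffOn_extChartAt_symm (σ v₀)).contMDiffAt
        ((isOpen_extChartAt_target _).mem_nhds (χ.map_source hvs))
    have h3 : mfderiv 𝓘(ℝ, E₁) I σ v = (mfderiv 𝓘(ℝ, E) I χ.symm (χ (σ v))).comp
        (mfderiv 𝓘(ℝ, E₁) 𝓘(ℝ, E) (fun v => χ (σ v)) v) := by
      have h4 := mfderiv_comp v h2 h1
      have h5 : χ.symm ∘ (fun v => χ (σ v)) =ᶠ[𝓝 v] σ := by
        filter_upwards [hvn] with w hw using χ.left_inv hw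
      rw [h5.mfderiv_eq] at h4
      exact h4
    have h6 : χ.symm (χ (σ v)) = σ v := χ.left_inv hvs
    change (Ω (σ v)).compContinuousLinearMap (mfderiv 𝓘(ℝ, E₁) I σ v) =
      ((Ω (χ.symm (χ (σ v)))).compContinuousLinearMap
        (mfderiv 𝓘(ℝ, E) I χ.symm (χ (σ v)))).compContinuousLinearMap _
    rw [h3, mfderiv_eq_fderiv]
    ext w
    change Ω (σ v) _ = Ω (χ.symm (χ (σ v))) _
    have h7 : ∀ (x x' : X) (_ : x = x') (w : Fin 2 → E),
      (show (E [⋀^Fin 2]→L[ℝ] ℝ) from Ω x) w = (show (E [⋀^Fin 2]→L[ℝ] ℝ) from Ω x') w := by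
      rintro x _ rfl w
      rfl
    exact h7 _ _ h6.symm _

theorem TwoForm.IsSymplectic.contDiffOn_pullback {Ω : TwoForm I X} (hΩ : Ω.IsSymplectic)
    {V : Set E₁} (hV : IsOpen V) {σ : E₁ → X} (hσ : ContMDiffOn 𝓘(ℝ, E₁) I ∞ σ V) :
    ContDiffOn ℝ ∞ (Ω.pullbackVec σ) V := by
  intro v₀ hv₀
  obtain ⟨A, hA, hAt, h⟩ := Ω.pullback_eventuallyEq hV hσ hv₀
  refine (ContDiffAt.congr_of_eventuallyEq ?_ h).contDiffWithinAt
  refine contDiff_compContinuousLinearMap₂.contDiffAt.comp (f := fun v =>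
    ((Ω.inChart (σ v₀) (A v), fderiv ℝ A v) : (E [⋀^Fin 2]→L[ℝ] ℝ) × (E₁ →L[ℝ] E))) v₀
    (ContDiffAt.prodMk ?_ (hA.fderiv_right (by simp)))
  exact ((hΩ.smooth (σ v₀)).contDiffAt
    ((isOpen_extChartAt_target _).mem_nhds hAt)).comp v₀ hA

theorem TwoForm.IsSymplectic.extDeriv_pullback {Ω : TwoForm I X} (hΩ : Ω.IsSymplectic)
    {V : Set E₁} (hV : IsOpen V) {σ : E₁ → X} (hσ : ContMDiffOn 𝓘(ℝ, E₁) I ∞ σ V)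
    {v₀ : E₁} (hv₀ : v₀ ∈ V) :
    extDeriv (Ω.pullbackVec σ) v₀ = 0 := by
  obtain ⟨A, hA, hAt, h⟩ := Ω.pullback_eventuallyEq hV hσ hv₀
  rw [h.extDeriv_eq, _root_.extDeriv_pullback (r := ∞) _ hA (by
    simp only [minSmoothness_of_isRCLikeNormedField]
    exact ENat.LEInfty.out),
    hΩ.closed _ _ hAt]
  · rfl
  · exact ((hΩ.smooth (σ v₀)).contDiffAt
      ((isOpen_extChartAt_target _).mem_nhds hAt)).differentiableAt (by simp)

end Pullback

section Submersion
open Topology Set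

variable {E : Type*} [NormedAddCommGroup E] [NormedSpace ℝ E]
  {E' : Type*} [NormedAddCommGroup E'] [NormedSpace ℝ E']
  {X : Type*} [TopologicalSpace X] [ChartedSpace E X]
  {Y : Type*} [TopologicalSpace Y] [ChartedSpace E' Y]

/-- A diffeomorphism from an open set `U` of `X` onto an open set `W` of `Y × ℝ^d` under which
`s : X → Y` corresponds to the first projection. -/
structure LocalTriv (E : Type*) [NormedAddCommGroup E] [NormedSpace ℝ E]
    (E' : Type*) [NormedAddCommGroup E'] [NormedSpace ℝ E']
    {X : Type*} [TopologicalSpace X] [ChartedSpace E X]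
    {Y : Type*} [TopologicalSpace Y] [ChartedSpace E' Y] (s : X → Y) (d : ℕ) where
  U : Set X
  W : Set (Y × EuclideanSpace ℝ (Fin d))
  fib : X → EuclideanSpace ℝ (Fin d)
  inv : Y × EuclideanSpace ℝ (Fin d) → X
  isOpen_U : IsOpen U
  isOpen_W : IsOpen W
  smooth_fib : ContMDiffOn 𝓘(ℝ, E) (𝓡 d) ∞ fib U
  smooth_inv : ContMDiffOn (𝓘(ℝ, E').prod (𝓡 d)) 𝓘(ℝ, E) ∞ inv W
  mem_W : ∀ x ∈ U, (s x, fib x) ∈ W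
  inv_fib : ∀ x ∈ U, inv (s x, fib x) = x
  inv_mem : ∀ w ∈ W, inv w ∈ U
  map_inv : ∀ w ∈ W, s (inv w) = w.1
  fib_inv : ∀ w ∈ W, fib (inv w) = w.2

theorem exists_localTriv [FiniteDimensional ℝ E] [FiniteDimensional ℝ E']
    [IsManifold 𝓘(ℝ, E) ∞ X] [IsManifold 𝓘(ℝ, E') ∞ Y] {s : X → Y}
    (h : IsSubmersion 𝓘(ℝ, E) 𝓘(ℝ, E') ∞ s) (x₀ : X) :
    ∃ T : LocalTriv E E' s (Module.finrank ℝ E - Module.finrank ℝ E'), x₀ ∈ T.U := by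
  obtain ⟨d, hd⟩ : ∃ d, d = Module.finrank ℝ E - Module.finrank ℝ E' := ⟨_, rfl⟩
  rw [← hd]
  obtain ⟨C, _, _, hC⟩ := h.isSubmersionAt x₀
  obtain ⟨φ, ψ, hxφ, hxψ, hφ, hψ, hφψ, L, hL⟩ := hC
  have hCfin : FiniteDimensional ℝ C := by
    have : FiniteDimensional ℝ (E' × C) := L.toLinearEquiv.finiteDimensional
    exact FiniteDimensional.of_surjective (LinearMap.snd ℝ E' C) LinearMap.snd_surjective
  have hdim : Module.finrank ℝ C = Module.finrank ℝ (EuclideanSpace ℝ (Fin d)) := by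
    have := L.toLinearEquiv.finrank_eq
    rw [Module.finrank_prod] at this
    rw [finrank_euclideanSpace_fin]
    omega
  let K := ContinuousLinearEquiv.ofFinrankEq hdim
  have hsφ : ∀ z ∈ φ.target, ψ (s (φ.symm z)) = (L z).1 := fun z hz => by
    have := hL (x := z) (by simpa using hz)
    simpa using this
  have hsφ' : ∀ x ∈ φ.source, ψ (s x) = (L (φ x)).1 := fun x hx => by
    rw [← hsφ _ (φ.map_source hx), φ.left_inv hx]
  let pre : Y × EuclideanSpace ℝ (Fin d) → E :=
    fun w => L.symm (ψ w.1, K.symm w.2)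
  have hψ' := contMDiffOn_of_mem_maximalAtlas hψ
  have hpre : ContMDiffOn (𝓘(ℝ, E').prod (𝓡 d)) 𝓘(ℝ, E) ∞ pre (Prod.fst ⁻¹' ψ.source) := by
    refine L.symm.contDiff.contMDiff.comp_contMDiffOn (ContMDiffOn.prodMk_space ?_ ?_)
    · exact hψ'.comp contMDiffOn_fst fun w hw => hw
    · exact K.symm.contDiff.contMDiff.comp_contMDiffOn contMDiffOn_snd
  have hpre' : ∀ x ∈ φ.source, pre (s x, K (L (φ x)).2) = φ x := fun x hx => by
    simp only [pre, hsφ' x hx, K.symm_apply_apply, Prod.mk.eta, L.symm_apply_apply]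
  refine ⟨{ U := φ.source
            W := Prod.fst ⁻¹' ψ.source ∩ pre ⁻¹' φ.target
            fib := fun x => K (L (φ x)).2
            inv := fun w => φ.symm (pre w)
            isOpen_U := φ.open_source
            isOpen_W := hpre.continuousOn.isOpen_inter_preimage
              (ψ.open_source.preimage continuous_fst) φ.open_target
            smooth_fib := ?_
            smooth_inv := ?_
            mem_W := fun x hx => ⟨hφψ hx, ?_⟩
            inv_fib := fun x hx => ?_
            inv_mem := fun w hw => φ.map_target hw.2
            map_inv := fun w hw => ?_
            fib_inv := fun w hw => ?_ }, hxφ⟩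
  · exact (K.contDiff.comp (contDiff_snd.comp L.contDiff)).contMDiff.comp_contMDiffOn
      (contMDiffOn_of_mem_maximalAtlas hφ)
  · exact (contMDiffOn_symm_of_mem_maximalAtlas hφ).comp (hpre.mono inter_subset_left)
      fun w hw => hw.2
  · rw [mem_preimage, hpre' x hx]
    exact φ.map_source hx
  · rw [hpre' x hx, φ.left_inv hx]
  · refine ψ.injOn (hφψ (φ.map_target hw.2)) hw.1 ?_
    rw [hsφ _ hw.2]
    simp [pre]
  · rw [φ.right_inv hw.2]
    simp [pre]

variable {s : X → Y} {d : ℕ}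

namespace LocalTriv

theorem contMDiffAt_section (T : LocalTriv E E' s d) {x : X} (hx : x ∈ T.U) :
    ContMDiffAt 𝓘(ℝ, E') 𝓘(ℝ, E) ∞ (fun y => T.inv (y, T.fib x)) (s x) :=
  ContMDiffAt.comp (g := T.inv) (s x) (T.smooth_inv.contMDiffAt
    (T.isOpen_W.mem_nhds (T.mem_W x hx))) (contMDiffAt_id.prodMk contMDiffAt_const)

theorem eventually_map_section (T : LocalTriv E E' s d) {x : X} (hx : x ∈ T.U) :
    ∀ᶠ y in 𝓝 (s x), (y, T.fib x) ∈ T.W :=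
  (Continuous.prodMk_left (T.fib x)).continuousAt.eventually_mem
    (T.isOpen_W.mem_nhds (T.mem_W x hx))

end LocalTriv

theorem mfderiv_surjective_of_localTriv (T : LocalTriv E E' s d)
    (hs : ContMDiff 𝓘(ℝ, E) 𝓘(ℝ, E') ∞ s) {x : X} (hx : x ∈ T.U) :
    Function.Surjective (mfderiv 𝓘(ℝ, E) 𝓘(ℝ, E') s x) := by
  intro v
  have h1 := ((T.contMDiffAt_section hx).mdifferentiableAt (by simp)).hasMFDerivAt
  have h0 : T.inv (s x, T.fib x) = x := T.inv_fib x hx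
  have h2 : HasMFDerivAt 𝓘(ℝ, E) 𝓘(ℝ, E') s (T.inv (s x, T.fib x))
      (mfderiv 𝓘(ℝ, E) 𝓘(ℝ, E') s x) := by
    rw [h0]
    exact (hs.mdifferentiableAt (by simp)).hasMFDerivAt
  have h3 := h2.comp (s x) h1
  have h4 : HasMFDerivAt 𝓘(ℝ, E') 𝓘(ℝ, E') (s ∘ fun y => T.inv (y, T.fib x)) (s x)
      (ContinuousLinearMap.id ℝ _) := by
    refine (hasMFDerivAt_id _).congr_of_eventuallyEq ?_
    filter_upwards [T.eventually_map_section hx] with y hy using T.map_inv _ hy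
  exact ⟨_, DFunLike.congr_fun (hasMFDerivAt_unique h3 h4) v⟩

end Submersion

namespace LieGroupoid
open Topology Set

variable {EG : Type*} [NormedAddCommGroup EG] [NormedSpace ℝ EG] [FiniteDimensional ℝ EG]
  {EM : Type*} [NormedAddCommGroup EM] [NormedSpace ℝ EM] [FiniteDimensional ℝ EM]
  {G : Type*} [TopologicalSpace G] [ChartedSpace EG G] [IsManifold 𝓘(ℝ, EG) ∞ G]
  {M : Type*} [TopologicalSpace M] [ChartedSpace EM M] [IsManifold 𝓘(ℝ, EM) ∞ M]
  (Γ : LieGroupoid 𝓘(ℝ, EG) 𝓘(ℝ, EM) G M)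

/-- The pairs of composable arrows. -/
def composable : Set (G × G) := {p | Γ.s p.1 = Γ.t p.2}

/-- The derivative of the source map. -/
def ds (g : G) : EG →L[ℝ] EM := mfderiv 𝓘(ℝ, EG) 𝓘(ℝ, EM) Γ.s g

/-- The derivative of the target map. -/
def dt (g : G) : EG →L[ℝ] EM := mfderiv 𝓘(ℝ, EG) 𝓘(ℝ, EM) Γ.t g

/-- The derivative of the unit map. -/
def de (x : M) : EM →L[ℝ] EG := mfderiv 𝓘(ℝ, EM) 𝓘(ℝ, EG) Γ.e x

/-- A derivative of the composition. -/
def dm (g h : G) : EG × EG →L[ℝ] EG :=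
  mfderivWithin (𝓘(ℝ, EG).prod 𝓘(ℝ, EG)) 𝓘(ℝ, EG) (fun p : G × G => Γ.m p.1 p.2)
    Γ.composable (g, h)

theorem smooth_s : ContMDiff 𝓘(ℝ, EG) 𝓘(ℝ, EM) ∞ Γ.s := Γ.isSubmersion_s.contMDiff

theorem smooth_t : ContMDiff 𝓘(ℝ, EG) 𝓘(ℝ, EM) ∞ Γ.t := Γ.isSubmersion_t.contMDiff

theorem hasMFDerivAt_s (g : G) : HasMFDerivAt 𝓘(ℝ, EG) 𝓘(ℝ, EM) Γ.s g (Γ.ds g) :=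
  (Γ.smooth_s.mdifferentiableAt (by simp)).hasMFDerivAt

theorem hasMFDerivAt_t (g : G) : HasMFDerivAt 𝓘(ℝ, EG) 𝓘(ℝ, EM) Γ.t g (Γ.dt g) :=
  (Γ.smooth_t.mdifferentiableAt (by simp)).hasMFDerivAt

theorem hasMFDerivAt_e (x : M) : HasMFDerivAt 𝓘(ℝ, EM) 𝓘(ℝ, EG) Γ.e x (Γ.de x) :=
  (Γ.smooth_e.mdifferentiableAt (by simp)).hasMFDerivAt

theorem hasMFDerivWithinAt_m {g h : G} (hgh : Γ.s g = Γ.t h) :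
    HasMFDerivWithinAt (𝓘(ℝ, EG).prod 𝓘(ℝ, EG)) 𝓘(ℝ, EG) (fun p : G × G => Γ.m p.1 p.2)
      Γ.composable (g, h) (Γ.dm g h) :=
  ((Γ.smooth_m (g, h) hgh).mdifferentiableWithinAt (by simp)).hasMFDerivWithinAt

theorem ds_surjective (g : G) : Function.Surjective (Γ.ds g) := by
  obtain ⟨T, hT⟩ := exists_localTriv Γ.isSubmersion_s g
  exact mfderiv_surjective_of_localTriv T Γ.smooth_s hT

theorem dt_surjective (g : G) : Function.Surjective (Γ.dt g) := by
  obtain ⟨T, hT⟩ := exists_localTriv Γ.isSubmersion_t g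
  exact mfderiv_surjective_of_localTriv T Γ.smooth_t hT

/-- The derivatives of a map along the pairs of composable arrows agree on the vectors tangent to
this set. -/
theorem hasMFDerivWithinAt_composable_unique {EZ : Type*} [NormedAddCommGroup EZ]
    [NormedSpace ℝ EZ] {Z : Type*} [TopologicalSpace Z] [ChartedSpace EZ Z] {f : G × G → Z}
    {g h : G} (hgh : Γ.s g = Γ.t h) {D₁ D₂ : EG × EG →L[ℝ] EZ}
    (h₁ : HasMFDerivWithinAt (𝓘(ℝ, EG).prod 𝓘(ℝ, EG)) 𝓘(ℝ, EZ) f Γ.composable (g, h) D₁)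
    (h₂ : HasMFDerivWithinAt (𝓘(ℝ, EG).prod 𝓘(ℝ, EG)) 𝓘(ℝ, EZ) f Γ.composable (g, h) D₂)
    {u v : EG} (huv : Γ.ds g u = Γ.dt h v) : D₁ (u, v) = D₂ (u, v) := by
  obtain ⟨d, T, hT⟩ : ∃ d, ∃ T : LocalTriv EG EM Γ.t d, h ∈ T.U :=
    ⟨_, exists_localTriv Γ.isSubmersion_t h⟩
  let Θ : G × EuclideanSpace ℝ (Fin d) → G × G := fun p => (p.1, T.inv (Γ.s p.1, p.2))
  let p₀ : G × EuclideanSpace ℝ (Fin d) := (g, T.fib h)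
  have hW₀ : (Γ.s g, T.fib h) ∈ T.W := by rw [hgh]; exact T.mem_W h hT
  have hinv₀ : T.inv (Γ.s g, T.fib h) = h := by rw [hgh]; exact T.inv_fib h hT
  let O : Set (G × EuclideanSpace ℝ (Fin d)) := (fun p => (Γ.s p.1, p.2)) ⁻¹' T.W
  have hcont : Continuous fun p : G × EuclideanSpace ℝ (Fin d) => (Γ.s p.1, p.2) :=
    (Γ.smooth_s.continuous.comp continuous_fst).prodMk continuous_snd
  have hO : IsOpen O := T.isOpen_W.preimage hcont
  have hΘO : O ⊆ Θ ⁻¹' Γ.composable := fun p hp => (T.map_inv _ hp).symm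
  have hinv : HasMFDerivAt (𝓘(ℝ, EM).prod (𝓡 d)) 𝓘(ℝ, EG) T.inv (Γ.s g, T.fib h)
      (mfderiv (𝓘(ℝ, EM).prod (𝓡 d)) 𝓘(ℝ, EG) T.inv (Γ.s g, T.fib h)) :=
    ((T.smooth_inv.contMDiffAt (T.isOpen_W.mem_nhds hW₀)).mdifferentiableAt
      (by simp)).hasMFDerivAt
  set B : EM × EuclideanSpace ℝ (Fin d) →L[ℝ] EG :=
    mfderiv (𝓘(ℝ, EM).prod (𝓡 d)) 𝓘(ℝ, EG) T.inv (Γ.s g, T.fib h)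
  have hpair : HasMFDerivAt (𝓘(ℝ, EG).prod (𝓡 d)) (𝓘(ℝ, EM).prod (𝓡 d))
      (fun p : G × EuclideanSpace ℝ (Fin d) => (Γ.s p.1, p.2)) p₀
      (((Γ.ds g).comp (ContinuousLinearMap.fst ℝ EG (EuclideanSpace ℝ (Fin d)))).prod
        (ContinuousLinearMap.snd ℝ EG (EuclideanSpace ℝ (Fin d)))) :=
    HasMFDerivAt.prodMk ((Γ.hasMFDerivAt_s g).comp p₀ (hasMFDerivAt_fst p₀)) (hasMFDerivAt_snd p₀)
  have hΘ : HasMFDerivAt (𝓘(ℝ, EG).prod (𝓡 d)) (𝓘(ℝ, EG).prod 𝓘(ℝ, EG)) Θ p₀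
      ((ContinuousLinearMap.fst ℝ EG (EuclideanSpace ℝ (Fin d))).prod
        (B.comp (((Γ.ds g).comp (ContinuousLinearMap.fst ℝ EG (EuclideanSpace ℝ (Fin d)))).prod
        (ContinuousLinearMap.snd ℝ EG (EuclideanSpace ℝ (Fin d)))))) :=
    HasMFDerivAt.prodMk (hasMFDerivAt_fst p₀) (HasMFDerivAt.comp (g := T.inv) p₀ hinv hpair)
  have hΘ₀ : Θ p₀ = (g, h) := Prod.ext rfl hinv₀
  rw [← hΘ₀] at h₁ h₂
  have hu := (hO.uniqueMDiffWithinAt (I := 𝓘(ℝ, EG).prod (𝓡 d)) (x := p₀) hW₀).eq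
    (h₁.comp p₀ hΘ.hasMFDerivWithinAt hΘO) (h₂.comp p₀ hΘ.hasMFDerivWithinAt hΘO)
  have hfib : HasMFDerivAt 𝓘(ℝ, EG) (𝓡 d) T.fib h (mfderiv 𝓘(ℝ, EG) (𝓡 d) T.fib h) :=
    ((T.smooth_fib.contMDiffAt (T.isOpen_U.mem_nhds hT)).mdifferentiableAt (by simp)).hasMFDerivAt
  set C : EG →L[ℝ] EuclideanSpace ℝ (Fin d) := mfderiv 𝓘(ℝ, EG) (𝓡 d) T.fib h
  have hBv : B (Γ.dt h v, C v) = v := by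
    have h3 : HasMFDerivAt 𝓘(ℝ, EG) (𝓘(ℝ, EM).prod (𝓡 d)) (fun b => (Γ.t b, T.fib b)) h
      ((Γ.dt h).prod (C)) :=
        HasMFDerivAt.prodMk (Γ.hasMFDerivAt_t h) hfib
    have h4 := HasMFDerivAt.comp (g := T.inv) h (by rw [← hgh]; exact hinv) h3
    have h5 : HasMFDerivAt 𝓘(ℝ, EG) 𝓘(ℝ, EG) (T.inv ∘ fun b => (Γ.t b, T.fib b)) h
        (ContinuousLinearMap.id ℝ _) := by
      refine (hasMFDerivAt_id _).congr_of_eventuallyEq ?_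
      filter_upwards [T.isOpen_U.mem_nhds hT] with b hb using T.inv_fib b hb
    exact DFunLike.congr_fun (hasMFDerivAt_unique h4 h5) v
  have key := DFunLike.congr_fun hu ((u, C v) : EG × EuclideanSpace ℝ (Fin d))
  change D₁ (u, B (Γ.ds g u, C v)) = D₂ (u, B (Γ.ds g u, C v)) at key
  rwa [huv, hBv] at key

theorem ds_dm {g h : G} (hgh : Γ.s g = Γ.t h) {u v : EG} (huv : Γ.ds g u = Γ.dt h v) :
    Γ.ds (Γ.m g h) (Γ.dm g h (u, v)) = Γ.ds h v := by
  have h1 := (Γ.hasMFDerivAt_s (Γ.m g h)).comp_hasMFDerivWithinAt (g, h)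
    (Γ.hasMFDerivWithinAt_m hgh)
  have h2 := (HasMFDerivAt.comp (g, h) (Γ.hasMFDerivAt_s h)
    (hasMFDerivAt_snd (I := 𝓘(ℝ, EG)) (I' := 𝓘(ℝ, EG)) (g, h))).hasMFDerivWithinAt
      (s := Γ.composable)
  exact Γ.hasMFDerivWithinAt_composable_unique hgh
    (h1.congr_mono (fun p hp => (Γ.s_m p.1 p.2 hp).symm) (Γ.s_m g h hgh).symm subset_rfl) h2 huv

theorem dt_dm {g h : G} (hgh : Γ.s g = Γ.t h) {u v : EG} (huv : Γ.ds g u = Γ.dt h v) :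
    Γ.dt (Γ.m g h) (Γ.dm g h (u, v)) = Γ.dt g u := by
  have h1 := (Γ.hasMFDerivAt_t (Γ.m g h)).comp_hasMFDerivWithinAt (g, h)
    (Γ.hasMFDerivWithinAt_m hgh)
  have h2 := (HasMFDerivAt.comp (g, h) (Γ.hasMFDerivAt_t g)
    (hasMFDerivAt_fst (I := 𝓘(ℝ, EG)) (I' := 𝓘(ℝ, EG)) (g, h))).hasMFDerivWithinAt
      (s := Γ.composable)
  exact Γ.hasMFDerivWithinAt_composable_unique hgh
    (h1.congr_mono (fun p hp => (Γ.t_m p.1 p.2 hp).symm) (Γ.t_m g h hgh).symm subset_rfl) h2 huv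

theorem ds_de (x : M) (w : EM) : Γ.ds (Γ.e x) (Γ.de x w) = w := by
  have h1 := (Γ.hasMFDerivAt_s (Γ.e x)).comp x (Γ.hasMFDerivAt_e x)
  have h2 : Γ.s ∘ Γ.e = id := funext Γ.s_e
  rw [h2] at h1
  exact DFunLike.congr_fun (hasMFDerivAt_unique h1 (hasMFDerivAt_id x)) w

theorem dt_de (x : M) (w : EM) : Γ.dt (Γ.e x) (Γ.de x w) = w := by
  have h1 := (Γ.hasMFDerivAt_t (Γ.e x)).comp x (Γ.hasMFDerivAt_e x)
  have h2 : Γ.t ∘ Γ.e = id := funext Γ.t_e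
  rw [h2] at h1
  exact DFunLike.congr_fun (hasMFDerivAt_unique h1 (hasMFDerivAt_id x)) w

theorem dm_unit (h : G) (v : EG) :
    Γ.dm (Γ.e (Γ.t h)) h (Γ.de (Γ.t h) (Γ.dt h v), v) = v := by
  have h1 : HasMFDerivAt 𝓘(ℝ, EG) (𝓘(ℝ, EG).prod 𝓘(ℝ, EG)) (fun b => (Γ.e (Γ.t b), b)) h
      (((Γ.de (Γ.t h)).comp (Γ.dt h)).prod (ContinuousLinearMap.id ℝ EG)) :=
    HasMFDerivAt.prodMk ((Γ.hasMFDerivAt_e (Γ.t h)).comp h (Γ.hasMFDerivAt_t h))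
      (hasMFDerivAt_id h)
  have h2 := HasMFDerivWithinAt.comp (f := fun b => (Γ.e (Γ.t b), b)) h
    (Γ.hasMFDerivWithinAt_m (Γ.s_e (Γ.t h)))
    (h1.hasMFDerivWithinAt (s := univ)) fun b _ => Γ.s_e (Γ.t b)
  rw [hasMFDerivWithinAt_univ] at h2
  have h3 : ((fun p : G × G => Γ.m p.1 p.2) ∘ fun b => (Γ.e (Γ.t b), b)) = id := funext Γ.e_m
  rw [h3] at h2
  exact DFunLike.congr_fun (hasMFDerivAt_unique h2 (hasMFDerivAt_id h)) v

end LieGroupoid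

/-- An alternating form of degree 2, as a bilinear map. -/
def ContinuousAlternatingMap.toBilin {E : Type*} [NormedAddCommGroup E] [NormedSpace ℝ E]
    (f : E [⋀^Fin 2]→L[ℝ] ℝ) : E →ₗ[ℝ] E →ₗ[ℝ] ℝ :=
  LinearMap.mk₂ ℝ (fun u v => f ![u, v])
    (fun u u' v => f.toMultilinearMap.cons_add ![v] u u')
    (fun c u v => f.toMultilinearMap.cons_smul ![v] c u)
    (fun u v v' => by
      have h : ∀ w, ![u, w] = Function.update ![u, 0] 1 w := fun w => by
        funext i
        fin_cases i <;> simp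
      rw [h (v + v'), h v, h v', ContinuousAlternatingMap.map_update_add])
    (fun c u v => by
      have h : ∀ w, ![u, w] = Function.update ![u, 0] 1 w := fun w => by
        funext i
        fin_cases i <;> simp
      rw [h (c • v), h v, ContinuousAlternatingMap.map_update_smul])

theorem ContinuousAlternatingMap.toBilin_swap {E : Type*} [NormedAddCommGroup E] [NormedSpace ℝ E]
    (f : E [⋀^Fin 2]→L[ℝ] ℝ) (u v : E) : f.toBilin u v = -f.toBilin v u := by
  have h : (![u, v] : Fin 2 → E) = ![v, u] ∘ Equiv.swap (0 : Fin 2) 1 := by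
    funext i
    fin_cases i <;> simp
  change f ![u, v] = -f ![v, u]
  rw [h]
  exact f.toAlternatingMap.map_swap _ (by decide)

theorem ContinuousAlternatingMap.ext_toBilin {E : Type*} [NormedAddCommGroup E] [NormedSpace ℝ E]
    {f f' : E [⋀^Fin 2]→L[ℝ] ℝ} (h : ∀ u v, f.toBilin u v = f'.toBilin u v) : f = f' := by
  ext w
  have hw : w = ![w 0, w 1] := by
    funext i
    fin_cases i <;> rfl
  rw [hw]
  exact h _ _

theorem ContinuousAlternatingMap.toBilin_compContinuousLinearMap {E : Type*}
    [NormedAddCommGroup E] [NormedSpace ℝ E] {E' : Type*} [NormedAddCommGroup E']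
    [NormedSpace ℝ E'] (f : E' [⋀^Fin 2]→L[ℝ] ℝ) (D : E →L[ℝ] E') (u v : E) :
    (f.compContinuousLinearMap D).toBilin u v = f.toBilin (D u) (D v) := by
  have h : D ∘ ![u, v] = ![D u, D v] := by
    funext i
    fin_cases i <;> rfl
  exact congrArg f h

theorem TwoForm.toBilin_pullback {E : Type*} [NormedAddCommGroup E] [NormedSpace ℝ E]
    {H : Type*} [TopologicalSpace H] {I : ModelWithCorners ℝ E H}
    {X : Type*} [TopologicalSpace X] [ChartedSpace H X]
    {E' : Type*} [NormedAddCommGroup E'] [NormedSpace ℝ E']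
    {H' : Type*} [TopologicalSpace H'] {I' : ModelWithCorners ℝ E' H'}
    {Y : Type*} [TopologicalSpace Y] [ChartedSpace H' Y]
    (Ω : TwoForm I X) {f : Y → X} {y : Y} {D : E' →L[ℝ] E} (hf : HasMFDerivAt I' I f y D)
    (u v : E') :
    ContinuousAlternatingMap.toBilin (E := E') (Ω.pullback I' f y) u v =
      ContinuousAlternatingMap.toBilin (E := E) (Ω (f y)) (D u) (D v) := by
  obtain rfl : mfderiv I' I f y = D := hf.mfderiv
  exact ContinuousAlternatingMap.toBilin_compContinuousLinearMap (E := E') (E' := E)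
    (Ω (f y)) (mfderiv I' I f y) u v

/-- Two subspaces that are orthogonal with respect to a nondegenerate bilinear form have
dimensions adding up to at most the total dimension. -/
theorem finrank_add_finrank_le_of_orthogonal {E : Type*} [AddCommGroup E] [Module ℝ E]
    [FiniteDimensional ℝ E] (B : E →ₗ[ℝ] E →ₗ[ℝ] ℝ) (hB : ∀ u, (∀ v, B u v = 0) → u = 0)
    {U V : Submodule ℝ E} (h : ∀ u ∈ U, ∀ v ∈ V, B u v = 0) :
    Module.finrank ℝ U + Module.finrank ℝ V ≤ Module.finrank ℝ E := by
  have h1 := Subspace.finrank_add_finrank_dualAnnihilator_eq V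
  let Φ : U →ₗ[ℝ] V.dualAnnihilator := (B.domRestrict U).codRestrict _ fun u =>
    (Submodule.mem_dualAnnihilator _).2 fun v hv => h u u.2 v hv
  have hΦ : Function.Injective Φ := by
    rw [injective_iff_map_eq_zero]
    intro u hu
    refine Subtype.ext (hB u fun v => ?_)
    exact LinearMap.congr_fun (congrArg Subtype.val hu) v
  have h2 := LinearMap.finrank_le_finrank_of_injective hΦ
  omega

namespace LieGroupoid
open Topology Set

variable {EG : Type*} [NormedAddCommGroup EG] [NormedSpace ℝ EG] [FiniteDimensional ℝ EG]
  {EM : Type*} [NormedAddCommGroup EM] [NormedSpace ℝ EM] [FiniteDimensional ℝ EM]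
  {G : Type*} [TopologicalSpace G] [ChartedSpace EG G] [IsManifold 𝓘(ℝ, EG) ∞ G]
  {M : Type*} [TopologicalSpace M] [ChartedSpace EM M] [IsManifold 𝓘(ℝ, EM) ∞ M]
  (Γ : LieGroupoid 𝓘(ℝ, EG) 𝓘(ℝ, EM) G M)

/-- The tangent space of the source fibre. -/
def kerS (g : G) : Submodule ℝ EG := LinearMap.ker (Γ.ds g).toLinearMap

/-- The tangent space of the target fibre. -/
def kerT (g : G) : Submodule ℝ EG := LinearMap.ker (Γ.dt g).toLinearMap

variable {Γ} in
theorem mem_kerS {g : G} {u : EG} : u ∈ Γ.kerS g ↔ Γ.ds g u = 0 := Iff.rfl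

variable {Γ} in
theorem mem_kerT {g : G} {u : EG} : u ∈ Γ.kerT g ↔ Γ.dt g u = 0 := Iff.rfl

theorem finrank_kerS (g : G) :
    Module.finrank ℝ (Γ.kerS g) + Module.finrank ℝ EM = Module.finrank ℝ EG := by
  have h := LinearMap.finrank_range_add_finrank_ker (Γ.ds g).toLinearMap
  rw [LinearMap.range_eq_top.2 (Γ.ds_surjective g), finrank_top] at h
  rw [← h, add_comm]
  rfl

theorem finrank_kerT (g : G) :
    Module.finrank ℝ (Γ.kerT g) + Module.finrank ℝ EM = Module.finrank ℝ EG := by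
  have h := LinearMap.finrank_range_add_finrank_ker (Γ.dt g).toLinearMap
  rw [LinearMap.range_eq_top.2 (Γ.dt_surjective g), finrank_top] at h
  rw [← h, add_comm]
  rfl

/-- The arrow `g⁻¹ g'`, for arrows with the same target. -/
theorem exists_m_eq {g g' : G} (h : Γ.t g = Γ.t g') :
    ∃ k, Γ.s g = Γ.t k ∧ Γ.s k = Γ.s g' ∧ Γ.m g k = g' := by
  have h1 : Γ.s (Γ.i g) = Γ.t g' := by rw [Γ.s_i, h]
  refine ⟨Γ.m (Γ.i g) g', ?_, Γ.s_m _ _ h1, ?_⟩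
  · rw [Γ.t_m _ _ h1, Γ.t_i]
  · rw [← Γ.m_assoc _ _ _ (Γ.t_i g).symm h1, Γ.m_i, h, Γ.e_m]

theorem dm_mem_kerS {g h : G} (hgh : Γ.s g = Γ.t h) {u : EG} (hu : u ∈ Γ.kerS g) :
    Γ.dm g h (u, 0) ∈ Γ.kerS (Γ.m g h) := by
  rw [mem_kerS, Γ.ds_dm hgh (by rw [mem_kerS.1 hu, map_zero]), map_zero]

theorem dt_dm_right {g h : G} (hgh : Γ.s g = Γ.t h) {u : EG} (hu : u ∈ Γ.kerS g) :
    Γ.dt (Γ.m g h) (Γ.dm g h (u, 0)) = Γ.dt g u :=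
  Γ.dt_dm hgh (by rw [mem_kerS.1 hu, map_zero])

theorem exists_mem_kerS_of_t_eq {g g' : G} (h : Γ.t g = Γ.t g') {u : EG} (hu : u ∈ Γ.kerS g) :
    ∃ u' ∈ Γ.kerS g', Γ.dt g' u' = Γ.dt g u := by
  obtain ⟨k, hgk, -, rfl⟩ := Γ.exists_m_eq h
  exact ⟨_, Γ.dm_mem_kerS hgk hu, Γ.dt_dm_right hgk hu⟩

variable (Ω : TwoForm 𝓘(ℝ, EG) G)

/-- The bilinear form given by a 2-form at a point. -/
def bilin (Ω : TwoForm 𝓘(ℝ, EG) G) (g : G) : EG →ₗ[ℝ] EG →ₗ[ℝ] ℝ :=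
  ContinuousAlternatingMap.toBilin (Ω g)

theorem bilin_swap (g : G) (u v : EG) : bilin Ω g u v = -bilin Ω g v u :=
  ContinuousAlternatingMap.toBilin_swap (E := EG) (Ω g) u v

variable {Γ Ω}

namespace IsSymplectic

variable (hΩ : Γ.IsSymplectic Ω)
include hΩ

theorem eq_zero_of_bilin {g : G} {u : EG} (h : ∀ v, bilin Ω g u v = 0) : u = 0 :=
  hΩ.isSymplectic.nondegenerate g u h

theorem bilin_dm {g h : G} (hgh : Γ.s g = Γ.t h) {u u' v v' : EG} (huv : Γ.ds g u = Γ.dt h v)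
    (huv' : Γ.ds g u' = Γ.dt h v') :
    bilin Ω (Γ.m g h) (Γ.dm g h (u, v)) (Γ.dm g h (u', v')) =
      bilin Ω g u u' + bilin Ω h v v' :=
  hΩ.isMultiplicative g h hgh (Γ.dm g h) (Γ.hasMFDerivWithinAt_m hgh) u u' v v' huv huv'

theorem bilin_de (x : M) (w w' : EM) : bilin Ω (Γ.e x) (Γ.de x w) (Γ.de x w') = 0 := by
  have hs : ∀ w, Γ.ds (Γ.e (Γ.t (Γ.e x))) (Γ.de (Γ.t (Γ.e x)) (Γ.dt (Γ.e x) (Γ.de x w))) =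
      Γ.dt (Γ.e x) (Γ.de x w) := fun w => Γ.ds_de _ _
  have h := hΩ.bilin_dm (Γ.s_e (Γ.t (Γ.e x))) (hs w) (hs w')
  rw [Γ.dm_unit, Γ.dm_unit, Γ.e_m, Γ.dt_de, Γ.dt_de, Γ.t_e] at h
  linarith

theorem dm_right_injective {g h : G} (hgh : Γ.s g = Γ.t h) {u : EG} (hu : u ∈ Γ.kerS g)
    (h0 : Γ.dm g h (u, 0) = 0) : u = 0 := by
  refine hΩ.eq_zero_of_bilin (g := g) fun u' => ?_
  obtain ⟨v', hv'⟩ := Γ.dt_surjective h (Γ.ds g u')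
  have := hΩ.bilin_dm hgh (u := u) (v := 0) (by rw [mem_kerS.1 hu, map_zero]) hv'.symm
  rw [h0] at this
  simpa using this.symm

theorem dm_left_injective {g h : G} (hgh : Γ.s g = Γ.t h) {v : EG} (hv : v ∈ Γ.kerT h)
    (h0 : Γ.dm g h (0, v) = 0) : v = 0 := by
  refine hΩ.eq_zero_of_bilin (g := h) fun v' => ?_
  obtain ⟨u', hu'⟩ := Γ.ds_surjective g (Γ.dt h v')
  have := hΩ.bilin_dm hgh (u := 0) (v := v) (by rw [mem_kerT.1 hv, map_zero]) hu'
  rw [h0] at this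
  simpa using this.symm

/-- The source fibres and the target fibres are symplectically orthogonal. -/
theorem bilin_kerS_kerT {h : G} {a b : EG} (ha : a ∈ Γ.kerS h) (hb : b ∈ Γ.kerT h) :
    bilin Ω h a b = 0 := by
  have hy := Γ.s_e (Γ.t h)
  have hm := Γ.e_m h
  have hR : ∀ u ∈ Γ.kerS (Γ.e (Γ.t h)), Γ.dm (Γ.e (Γ.t h)) h (u, 0) ∈ Γ.kerS h := fun u hu => by
    have := Γ.dm_mem_kerS hy hu
    rwa [hm] at this
  let R : Γ.kerS (Γ.e (Γ.t h)) →ₗ[ℝ] Γ.kerS h :=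
    (((Γ.dm (Γ.e (Γ.t h)) h).comp (ContinuousLinearMap.inl ℝ EG EG)).toLinearMap.domRestrict
      _).codRestrict _ fun u => hR u u.2
  have hRinj : Function.Injective R := by
    rw [injective_iff_map_eq_zero]
    intro u hu
    exact Subtype.ext (hΩ.dm_right_injective hy u.2 (congrArg Subtype.val hu))
  have hdim : Module.finrank ℝ (Γ.kerS (Γ.e (Γ.t h))) = Module.finrank ℝ (Γ.kerS h) := by
    have h1 := Γ.finrank_kerS (Γ.e (Γ.t h))
    have h2 := Γ.finrank_kerS h
    omega
  obtain ⟨a₀, ha₀⟩ := (LinearMap.injective_iff_surjective_of_finrank_eq_finrank hdim).1 hRinj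
    ⟨a, ha⟩
  have ha₀' : Γ.dm (Γ.e (Γ.t h)) h (a₀, 0) = a := congrArg Subtype.val ha₀
  have hb' : Γ.dm (Γ.e (Γ.t h)) h (0, b) = b := by
    have := Γ.dm_unit h b
    rwa [mem_kerT.1 hb, map_zero] at this
  have := hΩ.bilin_dm hy (u := a₀) (v := 0) (u' := 0) (v' := b)
    (by rw [mem_kerS.1 a₀.2, map_zero]) (by rw [mem_kerT.1 hb, map_zero])
  rw [ha₀', hb', hm] at this
  simpa using this

theorem finrank_eq (x : M) : Module.finrank ℝ EG = 2 * Module.finrank ℝ EM := by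
  have h1 := finrank_add_finrank_le_of_orthogonal (bilin Ω (Γ.e x))
    (fun u hu => hΩ.eq_zero_of_bilin hu) (U := Γ.kerS (Γ.e x)) (V := Γ.kerT (Γ.e x))
    fun u hu v hv => hΩ.bilin_kerS_kerT hu hv
  have h2 := finrank_add_finrank_le_of_orthogonal (bilin Ω (Γ.e x))
    (fun u hu => hΩ.eq_zero_of_bilin hu) (U := LinearMap.range (Γ.de x).toLinearMap)
    (V := LinearMap.range (Γ.de x).toLinearMap) (by
      rintro _ ⟨w, rfl⟩ _ ⟨w', rfl⟩
      exact hΩ.bilin_de x w w')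
  have h3 : Function.Injective (Γ.de x).toLinearMap :=
    Function.LeftInverse.injective (g := Γ.ds (Γ.e x)) (Γ.ds_de x)
  rw [LinearMap.finrank_range_of_inj h3] at h2
  have h4 := Γ.finrank_kerS (Γ.e x)
  have h5 := Γ.finrank_kerT (Γ.e x)
  omega

/-- The map `a ↦ Ω (a, de ·)` from the Lie algebroid to `T^*M` is surjective. -/
theorem exists_kerS_eq (x : M) (α : EM →L[ℝ] ℝ) :
    ∃ a ∈ Γ.kerS (Γ.e x), ∀ w, α w = bilin Ω (Γ.e x) a (Γ.de x w) := by
  let Φ : Γ.kerS (Γ.e x) →ₗ[ℝ] Module.Dual ℝ EM :=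
    ((bilin Ω (Γ.e x)).compl₂ (Γ.de x).toLinearMap).domRestrict _
  have hΦ : ∀ a w, Φ a w = bilin Ω (Γ.e x) a (Γ.de x w) := fun a w => rfl
  have hinj : Function.Injective Φ := by
    rw [injective_iff_map_eq_zero]
    intro a ha
    refine Subtype.ext (hΩ.eq_zero_of_bilin (g := Γ.e x) fun v => ?_)
    have hv : v - Γ.de x (Γ.dt (Γ.e x) v) ∈ Γ.kerT (Γ.e x) := by
      rw [mem_kerT, map_sub, Γ.dt_de, sub_self]
    have h1 := hΩ.bilin_kerS_kerT a.2 hv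
    have h2 := hΦ a (Γ.dt (Γ.e x) v)
    rw [ha, LinearMap.zero_apply] at h2
    rwa [map_sub, ← h2, sub_zero] at h1
  have hdim : Module.finrank ℝ (Γ.kerS (Γ.e x)) = Module.finrank ℝ (Module.Dual ℝ EM) := by
    have h1 := Γ.finrank_kerS (Γ.e x)
    have h2 := hΩ.finrank_eq x
    rw [Subspace.dual_finrank_eq]
    omega
  obtain ⟨a, ha⟩ := (LinearMap.injective_iff_surjective_of_finrank_eq_finrank hdim).1 hinj
    α.toLinearMap
  exact ⟨a, a.2, fun w => by rw [← hΦ, ha]; rfl⟩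

theorem bilin_congr {g : G} {u v u' v' : EG} (hu : u ∈ Γ.kerS g)
    (hv' : v' ∈ Γ.kerS g) (huu : Γ.dt g u = Γ.dt g u') (hvv : Γ.dt g v = Γ.dt g v') :
    bilin Ω g u v = bilin Ω g u' v' := by
  have h1 : v - v' ∈ Γ.kerT g := by rw [mem_kerT, map_sub, hvv, sub_self]
  have h2 : u - u' ∈ Γ.kerT g := by rw [mem_kerT, map_sub, huu, sub_self]
  have h3 := hΩ.bilin_kerS_kerT hu h1
  have h4 := hΩ.bilin_kerS_kerT hv' h2
  rw [bilin_swap] at h4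
  rw [map_sub] at h3
  rw [map_sub, LinearMap.sub_apply] at h4
  linarith

/-- On vectors tangent to the source fibres, `Ω` depends only on the images under the target
map. -/
theorem bilin_eq_of_t_eq {g g' : G} (h : Γ.t g = Γ.t g') {u v u' v' : EG} (hu : u ∈ Γ.kerS g)
    (hv : v ∈ Γ.kerS g) (hv' : v' ∈ Γ.kerS g')
    (huu : Γ.dt g u = Γ.dt g' u') (hvv : Γ.dt g v = Γ.dt g' v') :
    bilin Ω g u v = bilin Ω g' u' v' := by
  obtain ⟨k, hgk, -, rfl⟩ := Γ.exists_m_eq h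
  have h1 := hΩ.bilin_dm hgk (u := u) (v := 0) (u' := v) (v' := 0)
    (by rw [mem_kerS.1 hu, map_zero]) (by rw [mem_kerS.1 hv, map_zero])
  rw [map_zero, add_zero] at h1
  rw [← h1]
  exact hΩ.bilin_congr (Γ.dm_mem_kerS hgk hu) hv'
    (by rw [Γ.dt_dm_right hgk hu, huu]) (by rw [Γ.dt_dm_right hgk hv, hvv])

theorem bilin_eq_unit {g : G} {a u v : EG} (ha : a ∈ Γ.kerS (Γ.e (Γ.t g))) (hu : u ∈ Γ.kerS g)
    (hv : v ∈ Γ.kerS g) (hau : Γ.dt (Γ.e (Γ.t g)) a = Γ.dt g u) :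
    bilin Ω g u v = bilin Ω (Γ.e (Γ.t g)) a (Γ.de (Γ.t g) (Γ.dt g v)) := by
  have hy := Γ.s_e (Γ.t g)
  have h1 := hΩ.bilin_dm hy (u := a) (v := 0) (u' := Γ.de (Γ.t g) (Γ.dt g v)) (v' := v)
    (by rw [mem_kerS.1 ha, map_zero]) (Γ.ds_de _ _)
  have h2 := Γ.dm_mem_kerS hy ha
  have h3 := Γ.dt_dm_right hy ha
  rw [Γ.dm_unit, Γ.e_m, map_zero, LinearMap.zero_apply, add_zero] at h1
  rw [Γ.e_m] at h2 h3
  rw [← h1]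
  exact hΩ.bilin_congr hu hv (by rw [h3, hau]) rfl

theorem finrank_isotropy_le {g h : G} (hgh : Γ.s g = Γ.t h) :
    Module.finrank ℝ (Γ.kerS h ⊓ Γ.kerT h : Submodule ℝ EG) ≤
      Module.finrank ℝ (Γ.kerS (Γ.m g h) ⊓ Γ.kerT (Γ.m g h) : Submodule ℝ EG) := by
  have hL : ∀ v ∈ Γ.kerS h ⊓ Γ.kerT h,
      Γ.dm g h (0, v) ∈ Γ.kerS (Γ.m g h) ⊓ Γ.kerT (Γ.m g h) := fun v hv => by
    have h0 : Γ.ds g 0 = Γ.dt h v := by rw [mem_kerT.1 hv.2, map_zero]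
    exact ⟨mem_kerS.2 (by rw [Γ.ds_dm hgh h0, mem_kerS.1 hv.1]),
      mem_kerT.2 (by rw [Γ.dt_dm hgh h0, map_zero])⟩
  let L : (Γ.kerS h ⊓ Γ.kerT h : Submodule ℝ EG) →ₗ[ℝ]
      (Γ.kerS (Γ.m g h) ⊓ Γ.kerT (Γ.m g h) : Submodule ℝ EG) :=
    (((Γ.dm g h).comp (ContinuousLinearMap.inr ℝ EG EG)).toLinearMap.domRestrict
      _).codRestrict _ fun u => hL u u.2
  refine LinearMap.finrank_le_finrank_of_injective (f := L) ?_
  rw [injective_iff_map_eq_zero]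
  intro v hv
  exact Subtype.ext (hΩ.dm_left_injective hgh v.2.2 (congrArg Subtype.val hv))

/-- The dimension of the isotropy is constant along source fibres. -/
theorem finrank_isotropy_eq {g h : G} (hgh : Γ.s g = Γ.s h) :
    Module.finrank ℝ (Γ.kerS g ⊓ Γ.kerT g : Submodule ℝ EG) =
      Module.finrank ℝ (Γ.kerS h ⊓ Γ.kerT h : Submodule ℝ EG) := by
  have key : ∀ g h : G, Γ.s g = Γ.s h →
      Module.finrank ℝ (Γ.kerS h ⊓ Γ.kerT h : Submodule ℝ EG) ≤
        Module.finrank ℝ (Γ.kerS g ⊓ Γ.kerT g : Submodule ℝ EG) := by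
    intro g h hgh
    have h1 : Γ.s g = Γ.t (Γ.i h) := by rw [Γ.t_i, hgh]
    have h2 : Γ.s (Γ.m g (Γ.i h)) = Γ.t h := by rw [Γ.s_m _ _ h1, Γ.s_i]
    have h3 : Γ.m (Γ.m g (Γ.i h)) h = g := by
      rw [Γ.m_assoc _ _ _ h1 (Γ.s_i h), Γ.i_m, ← hgh, Γ.m_e]
    have := hΩ.finrank_isotropy_le h2
    rwa [h3] at this
  exact le_antisymm (key h g hgh.symm) (key g h hgh)

end IsSymplectic

end LieGroupoid

namespace LieGroupoid
open Topology Set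

variable {EG : Type*} [NormedAddCommGroup EG] [NormedSpace ℝ EG] [FiniteDimensional ℝ EG]
  {EM : Type*} [NormedAddCommGroup EM] [NormedSpace ℝ EM] [FiniteDimensional ℝ EM]
  {G : Type*} [TopologicalSpace G] [ChartedSpace EG G] [IsManifold 𝓘(ℝ, EG) ∞ G]
  {M : Type u} [TopologicalSpace M] [ChartedSpace EM M] [IsManifold 𝓘(ℝ, EM) ∞ M]
  (Γ : LieGroupoid 𝓘(ℝ, EG) 𝓘(ℝ, EM) G M) (x₀ : M)

/-- The isomorphism class of `x₀`. -/
def Orbit : Type u := {y : M // ∃ g, Γ.s g = x₀ ∧ Γ.t g = y}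

variable {Γ x₀} in
/-- The inclusion of an isomorphism class. -/
def Orbit.val (y : Γ.Orbit x₀) : M := Subtype.val y

theorem Orbit.val_injective : Function.Injective (Orbit.val : Γ.Orbit x₀ → M) :=
  Subtype.val_injective

/-- The target map from the source fibre to the isomorphism class. -/
def proj (g : {g : G // Γ.s g = x₀}) : Γ.Orbit x₀ := ⟨Γ.t g, g, g.2, rfl⟩

theorem proj_val (g : {g : G // Γ.s g = x₀}) : (Γ.proj x₀ g).val = Γ.t g := rfl

theorem proj_surjective : Function.Surjective (Γ.proj x₀) := by
  rintro ⟨_, g, hg, rfl⟩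
  exact ⟨⟨g, hg⟩, rfl⟩

instance : TopologicalSpace (Γ.Orbit x₀) := .coinduced (Γ.proj x₀) inferInstance

theorem isQuotientMap_proj : IsQuotientMap (Γ.proj x₀) := ⟨⟨rfl⟩, Γ.proj_surjective x₀⟩

theorem continuous_val : Continuous (Orbit.val : Γ.Orbit x₀ → M) :=
  (Γ.isQuotientMap_proj x₀).continuous_iff.2 (Γ.smooth_t.continuous.comp continuous_subtype_val)

theorem isOpenMap_proj : IsOpenMap (Γ.proj x₀) := by
  intro U hU
  rw [← (Γ.isQuotientMap_proj x₀).isOpen_preimage, isOpen_iff_mem_nhds]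
  rintro ⟨g, hg⟩ ⟨⟨g₁, hg₁⟩, hgU, h⟩
  have ht : Γ.t g₁ = Γ.t g := congrArg Orbit.val h
  obtain ⟨k, hgk, hk, hm⟩ := Γ.exists_m_eq ht.symm
  have hc : ∀ a : {g : G // Γ.s g = x₀}, Γ.s a = Γ.t k := fun a => by rw [a.2, ← hgk, hg]
  let R : {g : G // Γ.s g = x₀} → {g : G // Γ.s g = x₀} := fun a =>
    ⟨Γ.m a k, by rw [Γ.s_m _ _ (hc a), hk, hg₁]⟩
  have hR : Continuous R := by
    refine Continuous.subtype_mk ?_ _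
    exact Γ.smooth_m.continuousOn.comp_continuous
      (continuous_subtype_val.prodMk continuous_const) hc
  have hRg : R ⟨g, hg⟩ = ⟨g₁, hg₁⟩ := Subtype.ext hm
  refine Filter.mem_of_superset
    (hR.continuousAt.preimage_mem_nhds (by rw [hRg]; exact hU.mem_nhds hgU)) fun a ha => ?_
  exact ⟨R a, ha, Subtype.ext (Γ.t_m _ _ (hc a))⟩

instance [T2Space M] : T2Space (Γ.Orbit x₀) :=
  .of_injective_continuous (Orbit.val_injective Γ x₀) (Γ.continuous_val x₀)

instance [SecondCountableTopology G] : SecondCountableTopology (Γ.Orbit x₀) :=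
  have : SecondCountableTopology {g : G // Γ.s g = x₀} :=
    TopologicalSpace.Subtype.secondCountableTopology {g : G | Γ.s g = x₀}
  (Γ.isQuotientMap_proj x₀).secondCountableTopology (Γ.isOpenMap_proj x₀)

/-- The dimension of the isomorphism class of `x₀`. -/
def orbitDim : ℕ := Module.finrank ℝ EG - Module.finrank ℝ EM -
  Module.finrank ℝ (Γ.kerS (Γ.e x₀) ⊓ Γ.kerT (Γ.e x₀) : Submodule ℝ EG)

variable {Γ} in
/-- The rank of the target map restricted to a source fibre. -/
theorem IsSymplectic.finrank_range_fderiv {Ω : TwoForm 𝓘(ℝ, EG) G} (hΩ : Γ.IsSymplectic Ω)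
    {d : ℕ} (hd : d = Module.finrank ℝ EG - Module.finrank ℝ EM)
    (T : LocalTriv EG EM Γ.s d) {c : EuclideanSpace ℝ (Fin d)} (hc : (x₀, c) ∈ T.W) {y : M}
    (hy : Γ.t (T.inv (x₀, c)) ∈ (extChartAt 𝓘(ℝ, EM) y).source) :
    Module.finrank ℝ
      (fderiv ℝ (fun c => extChartAt 𝓘(ℝ, EM) y (Γ.t (T.inv (x₀, c)))) c).range =
        Γ.orbitDim x₀ := by
  set χ := extChartAt 𝓘(ℝ, EM) y
  let ξ : EuclideanSpace ℝ (Fin d) → G := fun c => T.inv (x₀, c)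
  have hO : ∀ᶠ c' in 𝓝 c, (x₀, c') ∈ T.W :=
    (Continuous.prodMk_right x₀).continuousAt.eventually_mem (T.isOpen_W.mem_nhds hc)
  have hξ : HasMFDerivAt (𝓡 d) 𝓘(ℝ, EG) ξ c (mfderiv (𝓡 d) 𝓘(ℝ, EG) ξ c) := by
    refine (ContMDiffAt.mdifferentiableAt (n := ∞) ?_ (by simp)).hasMFDerivAt
    exact ContMDiffAt.comp (g := T.inv) c (T.smooth_inv.contMDiffAt (T.isOpen_W.mem_nhds hc))
      (contMDiffAt_const.prodMk contMDiffAt_id)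
  set D : EuclideanSpace ℝ (Fin d) →L[ℝ] EG := mfderiv (𝓡 d) 𝓘(ℝ, EG) ξ c
  have hDinj : Function.Injective D := by
    have h1 : HasMFDerivAt 𝓘(ℝ, EG) (𝓡 d) T.fib (ξ c) (mfderiv 𝓘(ℝ, EG) (𝓡 d) T.fib (ξ c)) :=
      ((T.smooth_fib.contMDiffAt (T.isOpen_U.mem_nhds (T.inv_mem _ hc))).mdifferentiableAt
        (by simp)).hasMFDerivAt
    have h2 : HasMFDerivAt (𝓡 d) (𝓡 d) (T.fib ∘ ξ) c (ContinuousLinearMap.id ℝ _) := by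
      refine (hasMFDerivAt_id _).congr_of_eventuallyEq ?_
      filter_upwards [hO] with c' hc' using T.fib_inv _ hc'
    have h3 := hasMFDerivAt_unique (h1.comp c hξ) h2
    exact Function.LeftInverse.injective (g := (mfderiv 𝓘(ℝ, EG) (𝓡 d) T.fib (ξ c)))
      fun v => DFunLike.congr_fun h3 v
  have hDS : LinearMap.range D.toLinearMap = Γ.kerS (ξ c) := by
    refine Submodule.eq_of_le_of_finrank_eq ?_ ?_
    · rintro _ ⟨v, rfl⟩
      have h1 := (Γ.hasMFDerivAt_s (ξ c)).comp c hξ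
      have h2 : HasMFDerivAt (𝓡 d) 𝓘(ℝ, EM) (Γ.s ∘ ξ) c
          (0 : EuclideanSpace ℝ (Fin d) →L[ℝ] EM) := by
        refine (hasMFDerivAt_const x₀ c).congr_of_eventuallyEq ?_
        filter_upwards [hO] with c' hc' using T.map_inv _ hc'
      exact DFunLike.congr_fun (hasMFDerivAt_unique h1 h2) v
    · have h1 := Γ.finrank_kerS (ξ c)
      rw [LinearMap.finrank_range_of_inj hDinj, finrank_euclideanSpace_fin]
      omega
  have hχ : HasMFDerivAt 𝓘(ℝ, EM) 𝓘(ℝ, EM) χ (Γ.t (ξ c))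
      (mfderiv 𝓘(ℝ, EM) 𝓘(ℝ, EM) χ (Γ.t (ξ c))) := by
    refine (ContMDiffAt.mdifferentiableAt (n := ∞) ?_ (by simp)).hasMFDerivAt
    rw [extChartAt_source] at hy
    exact contMDiffAt_extChartAt' hy
  have hχinj : Function.Injective (mfderiv 𝓘(ℝ, EM) 𝓘(ℝ, EM) χ (Γ.t (ξ c))) :=
    (isInvertible_mfderiv_extChartAt hy).injective
  set A : EM →L[ℝ] EM := mfderiv 𝓘(ℝ, EM) 𝓘(ℝ, EM) χ (Γ.t (ξ c))
  have hf : fderiv ℝ (fun c => χ (Γ.t (T.inv (x₀, c)))) c = A ∘L Γ.dt (ξ c) ∘L D := by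
    rw [← mfderiv_eq_fderiv]
    exact (hχ.comp c ((Γ.hasMFDerivAt_t (ξ c)).comp c hξ)).mfderiv
  have hker : LinearMap.ker (A ∘L Γ.dt (ξ c) ∘L D).toLinearMap =
      (Γ.kerT (ξ c)).comap D.toLinearMap := by
    ext v
    change A (Γ.dt (ξ c) (D v)) = 0 ↔ Γ.dt (ξ c) (D v) = 0
    exact map_eq_zero_iff A hχinj
  have h1 := LinearMap.finrank_range_add_finrank_ker (A ∘L Γ.dt (ξ c) ∘L D).toLinearMap
  have h2 := (Submodule.equivMapOfInjective D.toLinearMap hDinj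
    ((Γ.kerT (ξ c)).comap D.toLinearMap)).finrank_eq
  rw [Submodule.map_comap_eq, hDS] at h2
  have h3 : Γ.s (ξ c) = Γ.s (Γ.e x₀) := by rw [Γ.s_e]; exact T.map_inv _ hc
  have h4 := hΩ.finrank_isotropy_eq h3
  rw [hker, h2, h4, finrank_euclideanSpace_fin] at h1
  rw [hf, orbitDim, ← hd]
  omega

/-- A chart of the isomorphism class of `x₀`, adapted to the inclusion in `M`, with a smooth lift
of its inverse to the source fibre of `x₀`. -/
def IsOrbitChart {k : ℕ} (φ : OpenPartialHomeomorph (Γ.Orbit x₀) (EuclideanSpace ℝ (Fin k)))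
    (σ : EuclideanSpace ℝ (Fin k) → G) : Prop :=
  IsSliceChart 𝓘(ℝ, EM) (Orbit.val : Γ.Orbit x₀ → M) φ ∧
  ContMDiffOn (𝓡 k) 𝓘(ℝ, EG) ∞ σ φ.target ∧
  ∀ v ∈ φ.target, Γ.s (σ v) = x₀ ∧ Γ.t (σ v) = (φ.symm v).val

variable {Γ} in
theorem IsSymplectic.exists_isOrbitChart {Ω : TwoForm 𝓘(ℝ, EG) G} (hΩ : Γ.IsSymplectic Ω)
    (y : Γ.Orbit x₀) :
    ∃ (φ : OpenPartialHomeomorph (Γ.Orbit x₀) (EuclideanSpace ℝ (Fin (Γ.orbitDim x₀))))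
      (σ : EuclideanSpace ℝ (Fin (Γ.orbitDim x₀)) → G),
      y ∈ φ.source ∧ Γ.IsOrbitChart x₀ φ σ := by
  obtain ⟨⟨g₀, hg₀⟩, rfl⟩ := Γ.proj_surjective x₀ y
  obtain ⟨d, hd, T, hT⟩ : ∃ d, d = Module.finrank ℝ EG - Module.finrank ℝ EM ∧
      ∃ T : LocalTriv EG EM Γ.s d, g₀ ∈ T.U := ⟨_, rfl, exists_localTriv Γ.isSubmersion_s g₀⟩
  set χ := extChartAt 𝓘(ℝ, EM) (Γ.t g₀) with hχ
  have hχo : IsOpen χ.source := isOpen_extChartAt_source _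
  have hχs : ContMDiffOn 𝓘(ℝ, EM) 𝓘(ℝ, EM) ∞ χ χ.source := by
    rw [hχ, extChartAt_source]
    exact contMDiffOn_extChartAt
  let ξ : EuclideanSpace ℝ (Fin d) → G := fun c => T.inv (x₀, c)
  let O₁ : Set (EuclideanSpace ℝ (Fin d)) := Prod.mk x₀ ⁻¹' T.W
  have hO₁ : IsOpen O₁ := T.isOpen_W.preimage (Continuous.prodMk_right x₀)
  have hξ : ContMDiffOn (𝓡 d) 𝓘(ℝ, EG) ∞ ξ O₁ :=
    T.smooth_inv.comp (contMDiff_const.prodMk contMDiff_id).contMDiffOn fun c hc => hc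
  have htξ : ContMDiffOn (𝓡 d) 𝓘(ℝ, EM) ∞ (fun c => Γ.t (ξ c)) O₁ :=
    Γ.smooth_t.comp_contMDiffOn hξ
  let O : Set (EuclideanSpace ℝ (Fin d)) := O₁ ∩ (fun c => Γ.t (ξ c)) ⁻¹' χ.source
  have hO : IsOpen O := htξ.continuousOn.isOpen_inter_preimage hO₁ hχo
  have hsξ : ∀ c ∈ O, Γ.s (ξ c) = x₀ := fun c hc => T.map_inv _ hc.1
  have hξg : ∀ g ∈ T.U, Γ.s g = x₀ → ξ (T.fib g) = g := fun g hg hgs => by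
    simp only [ξ, ← hgs, T.inv_fib g hg]
  have hc₀ : T.fib g₀ ∈ O := by
    refine ⟨?_, ?_⟩
    · have := T.mem_W g₀ hT
      rwa [hg₀] at this
    · simp only [mem_preimage, hξg g₀ hT hg₀]
      exact mem_extChartAt_source _
  have hf : ContDiffOn ℝ ∞ (fun c => χ (Γ.t (ξ c))) O := by
    rw [← contMDiffOn_iff_contDiffOn]
    exact hχs.comp (htξ.mono inter_subset_left) fun c hc => hc.2
  obtain ⟨U', V, p, σ, hU', hcU', hU'O, hV, hσ, hσU', hpU', hpV⟩ :=
    hf.exists_constantRank hO hc₀ fun c hc => hΩ.finrank_range_fderiv x₀ hd T hc.1 hc.2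
  have hξσ : ContMDiffOn (𝓡 (Γ.orbitDim x₀)) 𝓘(ℝ, EG) ∞ (fun v => ξ (σ v)) V :=
    hξ.comp (contMDiffOn_iff_contDiffOn.2 hσ) fun v hv => (hU'O (hσU' hv)).1
  have hsσ : ∀ v ∈ V, Γ.s (ξ (σ v)) = x₀ := fun v hv => hsξ _ (hU'O (hσU' hv))
  let P : Set {g : G // Γ.s g = x₀} := Subtype.val ⁻¹' (T.U ∩ T.fib ⁻¹' U')
  have hP : IsOpen P := (T.smooth_fib.continuousOn.isOpen_inter_preimage T.isOpen_U hU').preimage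
    continuous_subtype_val
  have hPχ : ∀ g ∈ P, Γ.t g ∈ χ.source := fun g hg => by
    have h1 := (hU'O hg.2).2
    simp only [mem_preimage, hξg _ hg.1 g.2] at h1
    exact h1
  have hPV : ∀ g ∈ P, p (χ (Γ.t g)) ∈ V ∧ Γ.t (ξ (σ (p (χ (Γ.t g))))) = Γ.t g := fun g hg => by
    obtain ⟨h1, h2⟩ := hpU' _ hg.2
    simp only [hξg _ hg.1 g.2] at h1 h2
    exact ⟨h1, χ.injOn (hU'O (hσU' h1)).2 (hPχ g hg) h2⟩
  open Classical in
  let inv : EuclideanSpace ℝ (Fin (Γ.orbitDim x₀)) → Γ.Orbit x₀ := fun v =>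
    if hv : v ∈ V then Γ.proj x₀ ⟨ξ (σ v), hsσ v hv⟩ else Γ.proj x₀ ⟨g₀, hg₀⟩
  have hinv : ∀ v (hv : v ∈ V), inv v = Γ.proj x₀ ⟨ξ (σ v), hsσ v hv⟩ := fun v hv => dif_pos hv
  have hinv' : ∀ v ∈ V, (inv v).val = Γ.t (ξ (σ v)) := fun v hv => by rw [hinv v hv, proj_val]
  have hσP : ∀ v (hv : v ∈ V), (⟨ξ (σ v), hsσ v hv⟩ : {g : G // Γ.s g = x₀}) ∈ P := fun v hv => by
    have h1 := (hU'O (hσU' hv)).1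
    refine ⟨T.inv_mem _ h1, ?_⟩
    change T.fib (T.inv (x₀, σ v)) ∈ U'
    rw [T.fib_inv _ h1]
    exact hσU' hv
  let φ : OpenPartialHomeomorph (Γ.Orbit x₀) (EuclideanSpace ℝ (Fin (Γ.orbitDim x₀))) :=
    { toFun := fun z => p (χ z.val)
      invFun := inv
      source := Γ.proj x₀ '' P
      target := V
      map_source' := by
        rintro _ ⟨g, hg, rfl⟩
        exact (hPV g hg).1
      map_target' := fun v hv => ⟨_, hσP v hv, (hinv v hv).symm⟩
      left_inv' := by
        rintro _ ⟨g, hg, rfl⟩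
        refine Orbit.val_injective Γ x₀ ?_
        rw [proj_val, hinv' _ (hPV g hg).1]
        exact (hPV g hg).2
      right_inv' := fun v hv => by
        rw [hinv' v hv]
        exact hpV v hv
      open_source := Γ.isOpenMap_proj x₀ _ hP
      open_target := hV
      continuousOn_toFun := by
        refine p.continuous.comp_continuousOn (hχs.continuousOn.comp
          (Γ.continuous_val x₀).continuousOn ?_)
        rintro _ ⟨g, hg, rfl⟩
        exact hPχ g hg
      continuousOn_invFun := by
        rw [continuousOn_iff_continuous_domRestrict]
        have h1 : V.domRestrict inv = fun v : V => Γ.proj x₀ ⟨ξ (σ v), hsσ v v.2⟩ :=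
          funext fun v => hinv v v.2
        rw [h1]
        exact (Γ.isQuotientMap_proj x₀).continuous.comp
          (Continuous.subtype_mk (continuousOn_iff_continuous_domRestrict.1 hξσ.continuousOn) _) }
  refine ⟨φ, fun v => ξ (σ v), ⟨⟨g₀, hg₀⟩, ⟨hT, hcU'⟩, rfl⟩, ⟨?_, fun x => p (χ x), χ.source, hχo,
    p.contDiff.contMDiff.comp_contMDiffOn hχs, ?_⟩, hξσ, fun v hv => ⟨hsσ v hv, (hinv' v hv).symm⟩⟩
  · exact (Γ.smooth_t.comp_contMDiffOn hξσ).congr hinv'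
  · rintro _ ⟨g, hg, rfl⟩
    exact ⟨hPχ g hg, rfl⟩

end LieGroupoid

namespace LieGroupoid
open Topology Set

variable {EG : Type*} [NormedAddCommGroup EG] [NormedSpace ℝ EG] [FiniteDimensional ℝ EG]
  {EM : Type*} [NormedAddCommGroup EM] [NormedSpace ℝ EM] [FiniteDimensional ℝ EM]
  {G : Type*} [TopologicalSpace G] [ChartedSpace EG G] [IsManifold 𝓘(ℝ, EG) ∞ G]
  {M : Type u} [TopologicalSpace M] [ChartedSpace EM M] [IsManifold 𝓘(ℝ, EM) ∞ M]
  (Γ : LieGroupoid 𝓘(ℝ, EG) 𝓘(ℝ, EM) G M) (x₀ : M)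

/-- A choice of an adapted chart around each point of an isomorphism class. -/
structure OrbitAtlas where
  chart : Γ.Orbit x₀ → OpenPartialHomeomorph (Γ.Orbit x₀) (EuclideanSpace ℝ (Fin (Γ.orbitDim x₀)))
  lift : Γ.Orbit x₀ → EuclideanSpace ℝ (Fin (Γ.orbitDim x₀)) → G
  mem_chart : ∀ y, y ∈ (chart y).source
  isOrbitChart : ∀ y, Γ.IsOrbitChart x₀ (chart y) (lift y)

variable {Γ x₀}

theorem IsSymplectic.nonempty_orbitAtlas {Ω : TwoForm 𝓘(ℝ, EG) G} (hΩ : Γ.IsSymplectic Ω) :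
    Nonempty (Γ.OrbitAtlas x₀) := by
  choose φ σ h1 h2 using hΩ.exists_isOrbitChart x₀
  exact ⟨⟨φ, σ, h1, h2⟩⟩

namespace OrbitAtlas

variable (A : Γ.OrbitAtlas x₀)

/-- The isomorphism class, as a manifold. -/
def Leaf (_ : Γ.OrbitAtlas x₀) : Type u := Γ.Orbit x₀

instance : TopologicalSpace A.Leaf := inferInstanceAs (TopologicalSpace (Γ.Orbit x₀))

instance [T2Space M] : T2Space A.Leaf := inferInstanceAs (T2Space (Γ.Orbit x₀))

instance [SecondCountableTopology G] : SecondCountableTopology A.Leaf :=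
  inferInstanceAs (SecondCountableTopology (Γ.Orbit x₀))

instance : ChartedSpace (EuclideanSpace ℝ (Fin (Γ.orbitDim x₀))) A.Leaf :=
  chartedSpaceOfCharts A.chart A.mem_chart

instance : IsManifold (𝓡 (Γ.orbitDim x₀)) ∞ A.Leaf :=
  isManifold_of_isSliceChart A.mem_chart fun y => (A.isOrbitChart y).1

/-- The inclusion of the isomorphism class. -/
def ι : A.Leaf → M := Orbit.val

/-- The point of the isomorphism class that is the target of an arrow. -/
def proj (g : {g : G // Γ.s g = x₀}) : A.Leaf := Γ.proj x₀ g

theorem ι_injective : Function.Injective A.ι := Orbit.val_injective Γ x₀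

theorem range_ι : range A.ι = {y | ∃ g : G, Γ.s g = x₀ ∧ Γ.t g = y} := Subtype.range_val

theorem continuous_ι : Continuous A.ι := Γ.continuous_val x₀

theorem continuous_proj : Continuous A.proj := (Γ.isQuotientMap_proj x₀).continuous

theorem isImmersion_ι : IsImmersion (𝓡 (Γ.orbitDim x₀)) 𝓘(ℝ, EM) ∞ A.ι :=
  isImmersion_of_isSliceChart A.continuous_ι A.mem_chart fun y => (A.isOrbitChart y).1

theorem smooth_ι : ContMDiff (𝓡 (Γ.orbitDim x₀)) 𝓘(ℝ, EM) ∞ A.ι := A.isImmersion_ι.contMDiff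

/-- A map to the isomorphism class is smooth if it lifts to a smooth map to the source fibre. -/
theorem contMDiffOn_of_lift {E' : Type*} [NormedAddCommGroup E'] [NormedSpace ℝ E'] {H' : Type*}
    [TopologicalSpace H'] {I' : ModelWithCorners ℝ E' H'} {X : Type*} [TopologicalSpace X]
    [ChartedSpace H' X] {S : Set X} (hS : IsOpen S) {f : X → A.Leaf} {l : X → G}
    (hl : ContMDiffOn I' 𝓘(ℝ, EG) ∞ l S) (hs : ∀ x ∈ S, Γ.s (l x) = x₀)
    (ht : ∀ x ∈ S, Γ.t (l x) = A.ι (f x)) : ContMDiffOn I' (𝓡 (Γ.orbitDim x₀)) ∞ f S := by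
  have hf : ContinuousOn f S := by
    rw [continuousOn_iff_continuous_domRestrict]
    have h1 : S.domRestrict f = fun x : S => A.proj ⟨l x, hs x x.2⟩ :=
      funext fun x => A.ι_injective (ht x x.2).symm
    rw [h1]
    exact A.continuous_proj.comp
      (Continuous.subtype_mk (continuousOn_iff_continuous_domRestrict.1 hl.continuousOn) _)
  intro x hx
  have hfx : ContinuousAt f x := hf.continuousAt (hS.mem_nhds hx)
  refine ContMDiffAt.contMDiffWithinAt ?_
  rw [contMDiffAt_iff_target]
  refine ⟨hfx, ?_⟩
  obtain ⟨-, q, O, hO, hq, hqφ⟩ := (A.isOrbitChart (f x)).1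
  have hmem : ∀ᶠ z in 𝓝 x, f z ∈ (A.chart (f x)).source :=
    hfx.eventually_mem ((A.chart (f x)).open_source.mem_nhds (A.mem_chart (f x)))
  have hlx : ContMDiffAt I' 𝓘(ℝ, EG) ∞ l x := hl.contMDiffAt (hS.mem_nhds hx)
  have hqx : ContMDiffAt I' (𝓡 (Γ.orbitDim x₀)) ∞ (fun z => q (Γ.t (l z))) x := by
    refine ContMDiffAt.comp (g := q) x (hq.contMDiffAt (hO.mem_nhds ?_))
      ((Γ.smooth_t _).comp x hlx)
    rw [ht x hx]
    exact (hqφ _ (A.mem_chart (f x))).1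
  refine hqx.congr_of_eventuallyEq ?_
  filter_upwards [hmem, hS.mem_nhds hx] with z hz hzS
  rw [ht z hzS]
  exact (hqφ _ hz).2.symm

/-- The derivative of the inclusion. -/
def dι (y : A.Leaf) : EuclideanSpace ℝ (Fin (Γ.orbitDim x₀)) →L[ℝ] EM :=
  mfderiv (𝓡 (Γ.orbitDim x₀)) 𝓘(ℝ, EM) A.ι y

theorem hasMFDerivAt_ι (y : A.Leaf) :
    HasMFDerivAt (𝓡 (Γ.orbitDim x₀)) 𝓘(ℝ, EM) A.ι y (A.dι y) :=
  (A.smooth_ι.mdifferentiableAt (by simp)).hasMFDerivAt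

theorem dι_injective (y : A.Leaf) : Function.Injective (A.dι y) := by
  obtain ⟨-, q, O, hO, hq, hqφ⟩ := (A.isOrbitChart y).1
  have h1 : HasMFDerivAt 𝓘(ℝ, EM) (𝓡 (Γ.orbitDim x₀)) q (A.ι y)
      (mfderiv 𝓘(ℝ, EM) (𝓡 (Γ.orbitDim x₀)) q (A.ι y)) :=
    ((hq.contMDiffAt (hO.mem_nhds (hqφ _ (A.mem_chart y)).1)).mdifferentiableAt
      (by simp)).hasMFDerivAt
  have h2 : q ∘ A.ι =ᶠ[𝓝 y] extChartAt (𝓡 (Γ.orbitDim x₀)) y := by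
    filter_upwards [(A.chart y).open_source.mem_nhds (A.mem_chart y)] with z hz using (hqφ z hz).2
  have h3 := (h1.comp y (A.hasMFDerivAt_ι y)).mfderiv
  rw [h2.mfderiv_eq] at h3
  have h4 := (isInvertible_mfderiv_extChartAt (I := 𝓡 (Γ.orbitDim x₀))
    (mem_extChartAt_source (I := 𝓡 (Γ.orbitDim x₀)) y)).injective
  rw [h3] at h4
  exact Function.Injective.of_comp h4

/-- An arrow from `x₀` to `y`. -/
def arrow (y : A.Leaf) : G := A.lift y (A.chart y y)

/-- The derivative at `y` of a smooth lift of the isomorphism class to the source fibre. -/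
def darrow (y : A.Leaf) : EuclideanSpace ℝ (Fin (Γ.orbitDim x₀)) →L[ℝ] EG :=
  (mfderiv (𝓡 (Γ.orbitDim x₀)) 𝓘(ℝ, EG) (A.lift y) (A.chart y y)).comp
    (mfderiv (𝓡 (Γ.orbitDim x₀)) (𝓡 (Γ.orbitDim x₀))
      (extChartAt (𝓡 (Γ.orbitDim x₀)) y) y)

theorem s_arrow (y : A.Leaf) : Γ.s (A.arrow y) = x₀ :=
  ((A.isOrbitChart y).2.2 _ ((A.chart y).map_source (A.mem_chart y))).1

theorem t_arrow (y : A.Leaf) : Γ.t (A.arrow y) = A.ι y := by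
  have h := ((A.isOrbitChart y).2.2 _ ((A.chart y).map_source (A.mem_chart y))).2
  rw [(A.chart y).left_inv (A.mem_chart y)] at h
  exact h

theorem contMDiffAt_lift (z : A.Leaf) {v : EuclideanSpace ℝ (Fin (Γ.orbitDim x₀))}
    (hv : v ∈ (A.chart z).target) :
    ContMDiffAt (𝓡 (Γ.orbitDim x₀)) 𝓘(ℝ, EG) ∞ (A.lift z) v :=
  (A.isOrbitChart z).2.1.contMDiffAt ((A.chart z).open_target.mem_nhds hv)

/-- The derivative of the lift of a chart. -/
def dlift (z : A.Leaf) (v : EuclideanSpace ℝ (Fin (Γ.orbitDim x₀))) :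
    EuclideanSpace ℝ (Fin (Γ.orbitDim x₀)) →L[ℝ] EG :=
  mfderiv (𝓡 (Γ.orbitDim x₀)) 𝓘(ℝ, EG) (A.lift z) v

theorem hasMFDerivAt_lift (z : A.Leaf) {v : EuclideanSpace ℝ (Fin (Γ.orbitDim x₀))}
    (hv : v ∈ (A.chart z).target) :
    HasMFDerivAt (𝓡 (Γ.orbitDim x₀)) 𝓘(ℝ, EG) (A.lift z) v (A.dlift z v) :=
  ((A.contMDiffAt_lift z hv).mdifferentiableAt (by simp)).hasMFDerivAt

theorem dlift_mem_kerS (z : A.Leaf) {v : EuclideanSpace ℝ (Fin (Γ.orbitDim x₀))}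
    (hv : v ∈ (A.chart z).target) (w : EuclideanSpace ℝ (Fin (Γ.orbitDim x₀))) :
    A.dlift z v w ∈ Γ.kerS (A.lift z v) := by
  have h1 := (Γ.hasMFDerivAt_s (A.lift z v)).comp v (A.hasMFDerivAt_lift z hv)
  have h2 : HasMFDerivAt (𝓡 (Γ.orbitDim x₀)) 𝓘(ℝ, EM) (Γ.s ∘ A.lift z) v
      (0 : EuclideanSpace ℝ (Fin (Γ.orbitDim x₀)) →L[ℝ] EM) := by
    refine (hasMFDerivAt_const x₀ v).congr_of_eventuallyEq ?_
    filter_upwards [(A.chart z).open_target.mem_nhds hv] with v' hv'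
      using ((A.isOrbitChart z).2.2 v' hv').1
  exact DFunLike.congr_fun (hasMFDerivAt_unique h1 h2) w

/-- The derivative of the inverse of a chart. -/
def dchartSymm (z : A.Leaf) (v : EuclideanSpace ℝ (Fin (Γ.orbitDim x₀))) :
    EuclideanSpace ℝ (Fin (Γ.orbitDim x₀)) →L[ℝ] EuclideanSpace ℝ (Fin (Γ.orbitDim x₀)) :=
  mfderiv (𝓡 (Γ.orbitDim x₀)) (𝓡 (Γ.orbitDim x₀)) (extChartAt (𝓡 (Γ.orbitDim x₀)) z).symm v

theorem extChartAt_target_eq (z : A.Leaf) :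
    (extChartAt (𝓡 (Γ.orbitDim x₀)) z).target = (A.chart z).target := by
  rw [extChartAt_target]
  simp only [mfld_simps]
  rfl

theorem dt_dlift (z : A.Leaf) {v : EuclideanSpace ℝ (Fin (Γ.orbitDim x₀))}
    (hv : v ∈ (A.chart z).target) (w : EuclideanSpace ℝ (Fin (Γ.orbitDim x₀))) :
    Γ.dt (A.lift z v) (A.dlift z v w) =
      A.dι ((extChartAt (𝓡 (Γ.orbitDim x₀)) z).symm v) (A.dchartSymm z v w) := by
  have h1 := (Γ.hasMFDerivAt_t (A.lift z v)).comp v (A.hasMFDerivAt_lift z hv)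
  have h2 : HasMFDerivAt (𝓡 (Γ.orbitDim x₀)) (𝓡 (Γ.orbitDim x₀))
      (extChartAt (𝓡 (Γ.orbitDim x₀)) z).symm v (A.dchartSymm z v) := by
    refine (ContMDiffAt.mdifferentiableAt (n := ∞) ?_ (by simp)).hasMFDerivAt
    refine (contMDiffOn_extChartAt_symm z).contMDiffAt
      ((isOpen_extChartAt_target _).mem_nhds ?_)
    rwa [A.extChartAt_target_eq]
  have h3 := (A.hasMFDerivAt_ι ((extChartAt (𝓡 (Γ.orbitDim x₀)) z).symm v)).comp v h2
  have h4 : Γ.t ∘ A.lift z =ᶠ[𝓝 v] A.ι ∘ (extChartAt (𝓡 (Γ.orbitDim x₀)) z).symm := by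
    filter_upwards [(A.chart z).open_target.mem_nhds hv] with v' hv'
      using ((A.isOrbitChart z).2.2 v' hv').2
  exact DFunLike.congr_fun (hasMFDerivAt_unique h1 (h3.congr_of_eventuallyEq h4)) w

theorem darrow_mem_kerS (y : A.Leaf) (w : EuclideanSpace ℝ (Fin (Γ.orbitDim x₀))) :
    A.darrow y w ∈ Γ.kerS (A.arrow y) :=
  A.dlift_mem_kerS y ((A.chart y).map_source (A.mem_chart y)) _

theorem dt_darrow (y : A.Leaf) (w : EuclideanSpace ℝ (Fin (Γ.orbitDim x₀))) :
    Γ.dt (A.arrow y) (A.darrow y w) = A.dι y w := by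
  have hy : A.chart y y ∈ (A.chart y).target := (A.chart y).map_source (A.mem_chart y)
  have h1 := (Γ.hasMFDerivAt_t (A.arrow y)).comp (A.chart y y) (A.hasMFDerivAt_lift y hy)
  have h2 : HasMFDerivAt (𝓡 (Γ.orbitDim x₀)) (𝓡 (Γ.orbitDim x₀))
      (extChartAt (𝓡 (Γ.orbitDim x₀)) y) y (mfderiv (𝓡 (Γ.orbitDim x₀)) (𝓡 (Γ.orbitDim x₀))
      (extChartAt (𝓡 (Γ.orbitDim x₀)) y) y) :=
    (contMDiffAt_extChartAt.mdifferentiableAt (n := ∞) (by simp)).hasMFDerivAt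
  have h3 := HasMFDerivAt.comp (g := Γ.t ∘ A.lift y) y h1 h2
  have h4 : A.ι =ᶠ[𝓝 y] (Γ.t ∘ A.lift y) ∘ (extChartAt (𝓡 (Γ.orbitDim x₀)) y) := by
    filter_upwards [(A.chart y).open_source.mem_nhds (A.mem_chart y)] with z hz
    have h5 := ((A.isOrbitChart y).2.2 _ ((A.chart y).map_source hz)).2
    rw [(A.chart y).left_inv hz] at h5
    exact h5.symm
  exact DFunLike.congr_fun
    (hasMFDerivAt_unique (h3.congr_of_eventuallyEq h4) (A.hasMFDerivAt_ι y)) w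

variable {Ω : TwoForm 𝓘(ℝ, EG) G}

/-- The tangent spaces of an isomorphism class are the images of those of the source fibre. -/
theorem exists_dι_eq_iff (hΩ : Γ.IsSymplectic Ω) {y : A.Leaf} {g : G} (hg : Γ.t g = A.ι y)
    {z : EM} : (∃ w, A.dι y w = z) ↔ ∃ u ∈ Γ.kerS g, Γ.dt g u = z := by
  have hle : LinearMap.range (A.dι y).toLinearMap ≤
      (Γ.kerS (A.arrow y)).map (Γ.dt (A.arrow y)).toLinearMap := by
    rintro _ ⟨w, rfl⟩
    exact ⟨_, A.darrow_mem_kerS y w, A.dt_darrow y w⟩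
  have heq := Submodule.eq_of_le_of_finrank_eq hle (by
    have h1 := LinearMap.finrank_range_add_finrank_ker
      ((Γ.dt (A.arrow y)).toLinearMap.domRestrict (Γ.kerS (A.arrow y)))
    have h2 : LinearMap.ker
        ((Γ.dt (A.arrow y)).toLinearMap.domRestrict (Γ.kerS (A.arrow y))) =
          (Γ.kerT (A.arrow y)).comap (Γ.kerS (A.arrow y)).subtype := LinearMap.ker_domRestrict _ _
    have h3 := Submodule.finrank_map_subtype_eq (Γ.kerS (A.arrow y))
      ((Γ.kerT (A.arrow y)).comap (Γ.kerS (A.arrow y)).subtype)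
    have h4 := hΩ.finrank_isotropy_eq (g := A.arrow y) (h := Γ.e x₀)
      (by rw [A.s_arrow, Γ.s_e])
    have h5 := Γ.finrank_kerS (A.arrow y)
    rw [Submodule.map_comap_subtype, h4] at h3
    rw [LinearMap.range_domRestrict, h2, ← h3] at h1
    rw [LinearMap.finrank_range_of_inj (A.dι_injective y), finrank_euclideanSpace_fin, orbitDim]
    omega)
  have h1 : (∃ w, A.dι y w = z) ↔ ∃ u ∈ Γ.kerS (A.arrow y), Γ.dt (A.arrow y) u = z := by
    have := SetLike.ext_iff.1 heq z
    exact this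
  rw [h1]
  have hag : Γ.t (A.arrow y) = Γ.t g := by rw [A.t_arrow, hg]
  constructor
  · rintro ⟨u, hu, rfl⟩
    exact Γ.exists_mem_kerS_of_t_eq hag hu
  · rintro ⟨u, hu, rfl⟩
    exact Γ.exists_mem_kerS_of_t_eq hag.symm hu

variable (Ω) in
/-- The 2-form on an isomorphism class whose pullback to the source fibre is the restriction
of `Ω`. -/
def form : TwoForm (𝓡 (Γ.orbitDim x₀)) A.Leaf :=
  fun y => ContinuousAlternatingMap.compContinuousLinearMap
    (show EG [⋀^Fin 2]→L[ℝ] ℝ from Ω (A.arrow y)) (A.darrow y)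

/-- A 2-form on an isomorphism class at a point, as a bilinear form. -/
def formBilin (ΩF : TwoForm (𝓡 (Γ.orbitDim x₀)) A.Leaf) (y : A.Leaf) :
    EuclideanSpace ℝ (Fin (Γ.orbitDim x₀)) →ₗ[ℝ]
      EuclideanSpace ℝ (Fin (Γ.orbitDim x₀)) →ₗ[ℝ] ℝ :=
  ContinuousAlternatingMap.toBilin (ΩF y)

theorem formBilin_form (y : A.Leaf) (w w' : EuclideanSpace ℝ (Fin (Γ.orbitDim x₀))) :
    A.formBilin (A.form Ω) y w w' = bilin Ω (A.arrow y) (A.darrow y w) (A.darrow y w') :=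
  ContinuousAlternatingMap.toBilin_compContinuousLinearMap (E' := EG) (Ω (A.arrow y)) _ w w'

theorem formBilin_eq (hΩ : Γ.IsSymplectic Ω) {y : A.Leaf} {g : G} (hg : Γ.t g = A.ι y)
    {u u' : EG} (hu' : u' ∈ Γ.kerS g)
    {w w' : EuclideanSpace ℝ (Fin (Γ.orbitDim x₀))} (hw : Γ.dt g u = A.dι y w)
    (hw' : Γ.dt g u' = A.dι y w') : A.formBilin (A.form Ω) y w w' = bilin Ω g u u' := by
  rw [formBilin_form]
  exact hΩ.bilin_eq_of_t_eq (by rw [A.t_arrow, hg]) (A.darrow_mem_kerS y w)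
    (A.darrow_mem_kerS y w') hu' (by rw [A.dt_darrow, hw]) (by rw [A.dt_darrow, hw'])

end OrbitAtlas

end LieGroupoid

namespace LieGroupoid
open Topology Set

section Sharp

variable {EG : Type*} [NormedAddCommGroup EG] [NormedSpace ℝ EG] [FiniteDimensional ℝ EG]
  {EM : Type*} [NormedAddCommGroup EM] [NormedSpace ℝ EM] [FiniteDimensional ℝ EM]
  {G : Type*} [TopologicalSpace G] [ChartedSpace EG G] [IsManifold 𝓘(ℝ, EG) ∞ G]
  {M : Type u} [TopologicalSpace M] [ChartedSpace EM M] [IsManifold 𝓘(ℝ, EM) ∞ M]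
  {Γ : LieGroupoid 𝓘(ℝ, EG) 𝓘(ℝ, EM) G M} {Ω : TwoForm 𝓘(ℝ, EG) G}
  {π : BivectorField 𝓘(ℝ, EM) M}

/-- The value of a bivector field at a point, as a bilinear form. -/
def cobilin (π : BivectorField 𝓘(ℝ, EM) M) (x : M) :
    (EM →L[ℝ] ℝ) →ₗ[ℝ] (EM →L[ℝ] ℝ) →ₗ[ℝ] ℝ :=
  ContinuousAlternatingMap.toBilin (π x)

variable (π) in
/-- `u = π^♯ α` at the point `x`. -/
def SharpAt (x : M) (α : EM →L[ℝ] ℝ) (u : EM) : Prop := ∀ β : EM →L[ℝ] ℝ, β u = cobilin π x α β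

theorem SharpAt.unique {x : M} {α : EM →L[ℝ] ℝ} {u u' : EM} (h : SharpAt π x α u)
    (h' : SharpAt π x α u') : u = u' :=
  (SeparatingDual.eq_iff_forall_dual_eq (R := ℝ)).2 fun β => (h β).trans (h' β).symm

theorem SharpAt.apply_eq_neg {x : M} {α β : EM →L[ℝ] ℝ} {u v : EM} (h : SharpAt π x α u)
    (h' : SharpAt π x β v) : β u = -α v := by
  rw [h β, h' α]
  exact ContinuousAlternatingMap.toBilin_swap (E := EM →L[ℝ] ℝ) (π x) α β

/-- The description of `π^♯` in terms of the Lie algebroid of a symplectic groupoid. -/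
theorem IsSymplectic.sharpAt_iff (hΩ : Γ.IsSymplectic Ω) (hint : Γ.Integrates Ω π) {x : M}
    {α : EM →L[ℝ] ℝ} {u : EM} : SharpAt π x α u ↔
      ∃ a ∈ Γ.kerS (Γ.e x), Γ.dt (Γ.e x) a = u ∧ ∀ w, α w = bilin Ω (Γ.e x) a (Γ.de x w) := by
  have key : ∀ a ∈ Γ.kerS (Γ.e x), (∀ w, α w = bilin Ω (Γ.e x) a (Γ.de x w)) →
      SharpAt π x α (Γ.dt (Γ.e x) a) := fun a ha h => hint x a ha α h
  constructor
  · intro h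
    obtain ⟨a, ha, haα⟩ := hΩ.exists_kerS_eq x α
    exact ⟨a, ha, (key a ha haα).unique h, haα⟩
  · rintro ⟨a, ha, rfl, haα⟩
    exact key a ha haα

theorem IsSymplectic.exists_sharpAt (hΩ : Γ.IsSymplectic Ω) (hint : Γ.Integrates Ω π) (x : M)
    (α : EM →L[ℝ] ℝ) : ∃ u, SharpAt π x α u := by
  obtain ⟨a, ha, h⟩ := hΩ.exists_kerS_eq x α
  exact ⟨_, (hΩ.sharpAt_iff hint).2 ⟨a, ha, rfl, h⟩⟩

theorem IsSymplectic.exists_sharpAt_iff (hΩ : Γ.IsSymplectic Ω) (hint : Γ.Integrates Ω π) {x : M}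
    {u : EM} : (∃ α, SharpAt π x α u) ↔ ∃ a ∈ Γ.kerS (Γ.e x), Γ.dt (Γ.e x) a = u := by
  simp only [hΩ.sharpAt_iff hint]
  constructor
  · rintro ⟨_, a, ha, h, -⟩
    exact ⟨a, ha, h⟩
  · rintro ⟨a, ha, h⟩
    exact ⟨LinearMap.toContinuousLinearMap
      ((bilin Ω (Γ.e x) a).comp (Γ.de x).toLinearMap), a, ha, h, fun _ => rfl⟩

end Sharp

namespace OrbitAtlas

variable {EG : Type*} [NormedAddCommGroup EG] [NormedSpace ℝ EG] [FiniteDimensional ℝ EG]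
  {EM : Type*} [NormedAddCommGroup EM] [NormedSpace ℝ EM] [FiniteDimensional ℝ EM]
  {G : Type*} [TopologicalSpace G] [ChartedSpace EG G] [IsManifold 𝓘(ℝ, EG) ∞ G]
  {M : Type u} [TopologicalSpace M] [ChartedSpace EM M] [IsManifold 𝓘(ℝ, EM) ∞ M]
  {Γ : LieGroupoid 𝓘(ℝ, EG) 𝓘(ℝ, EM) G M} {x₀ : M} (A : Γ.OrbitAtlas x₀)
  {Ω : TwoForm 𝓘(ℝ, EG) G} {π : BivectorField 𝓘(ℝ, EM) M}

theorem exists_dι_eq_iff_sharpAt (hΩ : Γ.IsSymplectic Ω) (hint : Γ.Integrates Ω π) {y : A.Leaf}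
    {u : EM} : (∃ w, A.dι y w = u) ↔ ∃ α, SharpAt π (A.ι y) α u := by
  rw [hΩ.exists_sharpAt_iff hint, A.exists_dι_eq_iff hΩ (Γ.t_e (A.ι y))]

theorem formBilin_of_sharpAt (hΩ : Γ.IsSymplectic Ω) (hint : Γ.Integrates Ω π) {y : A.Leaf}
    {α : EM →L[ℝ] ℝ} {v : EuclideanSpace ℝ (Fin (Γ.orbitDim x₀))}
    (h : SharpAt π (A.ι y) α (A.dι y v)) (w : EuclideanSpace ℝ (Fin (Γ.orbitDim x₀))) :
    A.formBilin (A.form Ω) y v w = α (A.dι y w) := by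
  obtain ⟨a, ha, hau, haα⟩ := (hΩ.sharpAt_iff hint).1 h
  have h1 := A.t_arrow y
  rw [← A.dt_darrow] at hau
  rw [formBilin_form, haα, ← A.dt_darrow]
  rw [← h1] at ha hau ⊢
  exact hΩ.bilin_eq_unit ha (A.darrow_mem_kerS y v) (A.darrow_mem_kerS y w) hau

theorem induces_form (hΩ : Γ.IsSymplectic Ω) (hint : Γ.Integrates Ω π) :
    π.Induces A.ι (A.form Ω) where
  tangent _ _ := A.exists_dι_eq_iff_sharpAt hΩ hint
  inverse _ _ _ h w := A.formBilin_of_sharpAt hΩ hint h w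

theorem eq_of_induces (hΩ : Γ.IsSymplectic Ω) (hint : Γ.Integrates Ω π)
    {ΩF ΩF' : TwoForm (𝓡 (Γ.orbitDim x₀)) A.Leaf} (h : π.Induces A.ι ΩF)
    (h' : π.Induces A.ι ΩF') : ΩF' = ΩF := by
  funext y
  refine ContinuousAlternatingMap.ext_toBilin
    (E := EuclideanSpace ℝ (Fin (Γ.orbitDim x₀))) fun v w => ?_
  obtain ⟨α, hα⟩ := (A.exists_dι_eq_iff_sharpAt hΩ hint (y := y)).1 ⟨v, rfl⟩
  exact (h'.inverse y v α hα w).trans (h.inverse y v α hα w).symm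

theorem inChart_form (hΩ : Γ.IsSymplectic Ω) (z : A.Leaf)
    {v : EuclideanSpace ℝ (Fin (Γ.orbitDim x₀))} (hv : v ∈ (A.chart z).target) :
    (A.form Ω).inChart z v = Ω.pullbackVec (A.lift z) v := by
  refine ContinuousAlternatingMap.ext_toBilin fun w w' => ?_
  have h := A.formBilin_eq hΩ (y := (extChartAt (𝓡 (Γ.orbitDim x₀)) z).symm v)
    ((A.isOrbitChart z).2.2 v hv).2 (A.dlift_mem_kerS z hv w') (A.dt_dlift z hv w)
    (A.dt_dlift z hv w')
  exact ((ContinuousAlternatingMap.toBilin_compContinuousLinearMap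
    (E' := EuclideanSpace ℝ (Fin (Γ.orbitDim x₀)))
    (A.form Ω ((extChartAt (𝓡 (Γ.orbitDim x₀)) z).symm v)) (A.dchartSymm z v) w w').trans h).trans
    (ContinuousAlternatingMap.toBilin_compContinuousLinearMap (E' := EG) (Ω (A.lift z v))
      (A.dlift z v) w w').symm

theorem eq_zero_of_formBilin (hΩ : Γ.IsSymplectic Ω) (hint : Γ.Integrates Ω π) {y : A.Leaf}
    {v : EuclideanSpace ℝ (Fin (Γ.orbitDim x₀))} (h : ∀ w, A.formBilin (A.form Ω) y v w = 0) :
    v = 0 := by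
  refine A.dι_injective y ?_
  rw [map_zero]
  obtain ⟨α, hα⟩ := (A.exists_dι_eq_iff_sharpAt hΩ hint (y := y)).1 ⟨v, rfl⟩
  refine SeparatingDual.eq_zero_of_forall_dual_eq_zero (R := ℝ) fun β => ?_
  obtain ⟨u, hu⟩ := hΩ.exists_sharpAt hint (A.ι y) β
  obtain ⟨w, rfl⟩ := (A.exists_dι_eq_iff_sharpAt hΩ hint).2 ⟨β, hu⟩
  rw [hα.apply_eq_neg hu, ← A.formBilin_of_sharpAt hΩ hint hα w, h w, neg_zero]

theorem isSymplectic_form (hΩ : Γ.IsSymplectic Ω) (hint : Γ.Integrates Ω π) :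
    (A.form Ω).IsSymplectic where
  smooth z := by
    rw [A.extChartAt_target_eq]
    exact (hΩ.isSymplectic.contDiffOn_pullback (A.chart z).open_target
      (A.isOrbitChart z).2.1).congr fun v hv => A.inChart_form hΩ z hv
  closed z v hv := by
    rw [A.extChartAt_target_eq] at hv
    have h : (A.form Ω).inChart z =ᶠ[𝓝 v] Ω.pullbackVec (A.lift z) := by
      filter_upwards [(A.chart z).open_target.mem_nhds hv] with v' hv' using A.inChart_form hΩ z hv'
    rw [h.extDeriv_eq]
    exact hΩ.isSymplectic.extDeriv_pullback (A.chart z).open_target (A.isOrbitChart z).2.1 hv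
  nondegenerate y _ h := A.eq_zero_of_formBilin hΩ hint (y := y) h

end OrbitAtlas

end LieGroupoid

namespace LieGroupoid
open Topology Set

namespace OrbitAtlas

variable {EG : Type*} [NormedAddCommGroup EG] [NormedSpace ℝ EG] [FiniteDimensional ℝ EG]
  {EM : Type*} [NormedAddCommGroup EM] [NormedSpace ℝ EM] [FiniteDimensional ℝ EM]
  {G : Type*} [TopologicalSpace G] [ChartedSpace EG G] [IsManifold 𝓘(ℝ, EG) ∞ G]
  {M : Type u} [TopologicalSpace M] [ChartedSpace EM M] [IsManifold 𝓘(ℝ, EM) ∞ M]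
  {Γ : LieGroupoid 𝓘(ℝ, EG) 𝓘(ℝ, EM) G M} {x₀ : M} (A : Γ.OrbitAtlas x₀)
  {Ω : TwoForm 𝓘(ℝ, EG) G}

/-- Compatible vectors at composable arrows satisfy the equation that multiplicativity of `Ω` imposes
on the graph of the action. -/
theorem formBilin_actionGraph (hΩ : Γ.IsSymplectic Ω) {g : G} {x y : A.Leaf} (hx : Γ.s g = A.ι x)
    (hy : Γ.t g = A.ι y) {v v' : EG} {w w' z z' : EuclideanSpace ℝ (Fin (Γ.orbitDim x₀))}
    (hw : Γ.ds g v = A.dι x w) (hw' : Γ.ds g v' = A.dι x w') (hz : Γ.dt g v = A.dι y z)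
    (hz' : Γ.dt g v' = A.dι y z') :
    A.formBilin (A.form Ω) y z z' = bilin Ω g v v' + A.formBilin (A.form Ω) x w w' := by
  have hgh : Γ.s g = Γ.t (A.arrow x) := by rw [hx, A.t_arrow]
  have h1 : Γ.ds g v = Γ.dt (A.arrow x) (A.darrow x w) := by rw [hw, A.dt_darrow]
  have h1' : Γ.ds g v' = Γ.dt (A.arrow x) (A.darrow x w') := by rw [hw', A.dt_darrow]
  rw [A.formBilin_eq hΩ (y := y) (g := Γ.m g (A.arrow x)) (by rw [Γ.t_m _ _ hgh, hy])
    (u := Γ.dm g (A.arrow x) (v, A.darrow x w)) (u' := Γ.dm g (A.arrow x) (v', A.darrow x w'))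
    (by rw [mem_kerS, Γ.ds_dm hgh h1', mem_kerS.1 (A.darrow_mem_kerS x w')])
    (by rw [Γ.dt_dm hgh h1, hz]) (by rw [Γ.dt_dm hgh h1', hz']),
    hΩ.bilin_dm hgh h1 h1', formBilin_form]

theorem toBilin_actionForm (p : G × A.Leaf × A.Leaf)
    (u u' : EG × EuclideanSpace ℝ (Fin (Γ.orbitDim x₀)) ×
      EuclideanSpace ℝ (Fin (Γ.orbitDim x₀))) :
    ContinuousAlternatingMap.toBilin
      (E := EG × EuclideanSpace ℝ (Fin (Γ.orbitDim x₀)) ×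
        EuclideanSpace ℝ (Fin (Γ.orbitDim x₀)))
      (actionForm Ω (A.form Ω) p) u u' =
    -bilin Ω p.1 u.1 u'.1 - A.formBilin (A.form Ω) p.2.1 u.2.1 u'.2.1 +
      A.formBilin (A.form Ω) p.2.2 u.2.2 u'.2.2 := by
  have h1 := Ω.toBilin_pullback (f := fun p : G × A.Leaf × A.Leaf => p.1)
    (I' := 𝓘(ℝ, EG).prod ((𝓡 (Γ.orbitDim x₀)).prod (𝓡 (Γ.orbitDim x₀)))) (hasMFDerivAt_fst p) u u'
  have h2 := (A.form Ω).toBilin_pullback (f := fun p : G × A.Leaf × A.Leaf => p.2.1)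
    (I' := 𝓘(ℝ, EG).prod ((𝓡 (Γ.orbitDim x₀)).prod (𝓡 (Γ.orbitDim x₀))))
    ((hasMFDerivAt_fst p.2).comp p (hasMFDerivAt_snd p)) u u'
  have h3 := (A.form Ω).toBilin_pullback (f := fun p : G × A.Leaf × A.Leaf => p.2.2)
    (I' := 𝓘(ℝ, EG).prod ((𝓡 (Γ.orbitDim x₀)).prod (𝓡 (Γ.orbitDim x₀))))
    ((hasMFDerivAt_snd p.2).comp p (hasMFDerivAt_snd p)) u u'
  exact congrArg₂ (· + ·) (congrArg₂ (· - ·) (congrArg Neg.neg h1) h2) h3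

/-- The form of the action pulls back to zero along maps to the graph of the action. -/
theorem pullback_actionForm (hΩ : Γ.IsSymplectic Ω) {n : ℕ} {Y : Type*} [TopologicalSpace Y]
    [ChartedSpace (EuclideanSpace ℝ (Fin n)) Y] {f : Y → G × A.Leaf × A.Leaf}
    (hf : ContMDiff (𝓡 n) (𝓘(ℝ, EG).prod ((𝓡 (Γ.orbitDim x₀)).prod (𝓡 (Γ.orbitDim x₀)))) ∞ f)
    (hfL : ∀ y, f y ∈ Γ.actionGraph A.ι) :
    (actionForm Ω (A.form Ω)).pullback (𝓡 n) f = 0 := by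
  funext p
  obtain ⟨D, hD⟩ : ∃ D : EuclideanSpace ℝ (Fin n) →L[ℝ]
      EG × EuclideanSpace ℝ (Fin (Γ.orbitDim x₀)) × EuclideanSpace ℝ (Fin (Γ.orbitDim x₀)),
      HasMFDerivAt (𝓡 n) (𝓘(ℝ, EG).prod ((𝓡 (Γ.orbitDim x₀)).prod (𝓡 (Γ.orbitDim x₀)))) f p D :=
    ⟨_, (hf.mdifferentiableAt (by simp)).hasMFDerivAt⟩
  have h1 : HasMFDerivAt (𝓡 n) 𝓘(ℝ, EG) (fun z => (f z).1) p
      ((ContinuousLinearMap.fst ℝ _ _).comp D) := (hasMFDerivAt_fst (f p)).comp p hD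
  have h2 : HasMFDerivAt (𝓡 n) (𝓡 (Γ.orbitDim x₀)) (fun z => (f z).2.1) p
      ((ContinuousLinearMap.fst ℝ _ _).comp ((ContinuousLinearMap.snd ℝ _ _).comp D)) :=
    (hasMFDerivAt_fst (f p).2).comp p ((hasMFDerivAt_snd (f p)).comp p hD)
  have h3 : HasMFDerivAt (𝓡 n) (𝓡 (Γ.orbitDim x₀)) (fun z => (f z).2.2) p
      ((ContinuousLinearMap.snd ℝ _ _).comp ((ContinuousLinearMap.snd ℝ _ _).comp D)) :=
    (hasMFDerivAt_snd (f p).2).comp p ((hasMFDerivAt_snd (f p)).comp p hD)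
  have hs := hasMFDerivAt_unique ((Γ.hasMFDerivAt_s (f p).1).comp p h1)
    (((A.hasMFDerivAt_ι (f p).2.1).comp p h2).congr_of_eventuallyEq
      (Filter.Eventually.of_forall fun z => (hfL z).1))
  have ht := hasMFDerivAt_unique ((Γ.hasMFDerivAt_t (f p).1).comp p h1)
    (((A.hasMFDerivAt_ι (f p).2.2).comp p h3).congr_of_eventuallyEq
      (Filter.Eventually.of_forall fun z => (hfL z).2))
  refine ContinuousAlternatingMap.ext_toBilin (E := EuclideanSpace ℝ (Fin n)) fun w w' => ?_
  have h4 := A.formBilin_actionGraph hΩ (hfL p).1 (hfL p).2 (DFunLike.congr_fun hs w)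
    (DFunLike.congr_fun hs w') (DFunLike.congr_fun ht w) (DFunLike.congr_fun ht w')
  have h5 := A.toBilin_actionForm (Ω := Ω) (f p) (D w) (D w')
  have h7 : -bilin Ω (f p).1 (D w).1 (D w').1 -
      A.formBilin (A.form Ω) (f p).2.1 (D w).2.1 (D w').2.1 +
      A.formBilin (A.form Ω) (f p).2.2 (D w).2.2 (D w').2.2 = 0 := by
    have h8 : A.formBilin (A.form Ω) (f p).2.2 (D w).2.2 (D w').2.2 =
      bilin Ω (f p).1 (D w).1 (D w').1 +
        A.formBilin (A.form Ω) (f p).2.1 (D w).2.1 (D w').2.1 := h4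
    rw [h8]
    ring
  exact ((actionForm Ω (A.form Ω)).toBilin_pullback hD w w').trans (h5.trans h7)

theorem exists_isSliceChart_actionGraph {n : ℕ}
    (hn : n = Γ.orbitDim x₀ + (Module.finrank ℝ EG - Module.finrank ℝ EM))
    (p₀ : Γ.actionGraph A.ι) :
    ∃ φ : OpenPartialHomeomorph (Γ.actionGraph A.ι) (EuclideanSpace ℝ (Fin n)),
      p₀ ∈ φ.source ∧
      IsSliceChart (𝓘(ℝ, EG).prod ((𝓡 (Γ.orbitDim x₀)).prod (𝓡 (Γ.orbitDim x₀))))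
        (Subtype.val : Γ.actionGraph A.ι → G × A.Leaf × A.Leaf) φ := by
  set k := Γ.orbitDim x₀
  obtain ⟨d, hd, T, hT⟩ : ∃ d, d = Module.finrank ℝ EG - Module.finrank ℝ EM ∧
      ∃ T : LocalTriv EG EM Γ.s d, p₀.1.1 ∈ T.U :=
    ⟨_, rfl, exists_localTriv Γ.isSubmersion_s p₀.1.1⟩
  rw [← hd] at hn
  let Λ : (EuclideanSpace ℝ (Fin k) × EuclideanSpace ℝ (Fin d)) ≃L[ℝ] EuclideanSpace ℝ (Fin n) :=
    ContinuousLinearEquiv.ofFinrankEq (by simp [hn])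
  let φ : OpenPartialHomeomorph A.Leaf (EuclideanSpace ℝ (Fin k)) := A.chart p₀.1.2.1
  let σ : EuclideanSpace ℝ (Fin k) → G := A.lift p₀.1.2.1
  have hφ₀ : p₀.1.2.1 ∈ φ.source := A.mem_chart _
  have hιφ : ContMDiffOn (𝓡 k) 𝓘(ℝ, EM) ∞ (fun v => A.ι (φ.symm v)) φ.target :=
    (A.isOrbitChart p₀.1.2.1).1.1
  have hσ : ContMDiffOn (𝓡 k) 𝓘(ℝ, EG) ∞ σ φ.target := (A.isOrbitChart p₀.1.2.1).2.1
  have hsσ : ∀ v ∈ φ.target, Γ.s (σ v) = x₀ := fun v hv =>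
    ((A.isOrbitChart p₀.1.2.1).2.2 v hv).1
  have htσ : ∀ v ∈ φ.target, Γ.t (σ v) = A.ι (φ.symm v) := fun v hv =>
    ((A.isOrbitChart p₀.1.2.1).2.2 v hv).2
  have hφs : ContMDiffOn (𝓡 k) (𝓡 k) ∞ φ φ.source :=
    contMDiffOn_extChartAt (I := 𝓡 k) (x := p₀.1.2.1)
  let V₁ : Set (EuclideanSpace ℝ (Fin n)) := (fun u => (Λ.symm u).1) ⁻¹' φ.target
  have hpr₁ : ContMDiff (𝓡 n) (𝓡 k) ∞ fun u => (Λ.symm u).1 :=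
    (contDiff_fst.comp Λ.symm.contDiff).contMDiff
  have hpr₂ : ContMDiff (𝓡 n) (𝓡 d) ∞ fun u => (Λ.symm u).2 :=
    (contDiff_snd.comp Λ.symm.contDiff).contMDiff
  have hV₁ : IsOpen V₁ := φ.open_target.preimage hpr₁.continuous
  let b : EuclideanSpace ℝ (Fin n) → M × EuclideanSpace ℝ (Fin d) := fun u =>
    (A.ι (φ.symm (Λ.symm u).1), (Λ.symm u).2)
  have hb : ContMDiffOn (𝓡 n) (𝓘(ℝ, EM).prod (𝓡 d)) ∞ b V₁ :=
    (hιφ.comp hpr₁.contMDiffOn fun u hu => hu).prodMk hpr₂.contMDiffOn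
  let V : Set (EuclideanSpace ℝ (Fin n)) := V₁ ∩ b ⁻¹' T.W
  have hV : IsOpen V := hb.continuousOn.isOpen_inter_preimage hV₁ T.isOpen_W
  have hγ : ContMDiffOn (𝓡 n) 𝓘(ℝ, EG) ∞ (fun u => T.inv (b u)) V :=
    T.smooth_inv.comp (hb.mono inter_subset_left) fun u hu => hu.2
  have hsγ : ∀ u ∈ V, Γ.s (T.inv (b u)) = A.ι (φ.symm (Λ.symm u).1) := fun u hu =>
    T.map_inv _ hu.2
  have hσV : ContMDiffOn (𝓡 n) 𝓘(ℝ, EG) ∞ (fun u => σ (Λ.symm u).1) V :=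
    hσ.comp hpr₁.contMDiffOn fun u hu => hu.1
  have hcomp : ∀ u ∈ V, Γ.s (T.inv (b u)) = Γ.t (σ (Λ.symm u).1) := fun u hu => by
    rw [hsγ u hu, htσ _ hu.1]
  have hl : ContMDiffOn (𝓡 n) 𝓘(ℝ, EG) ∞ (fun u => Γ.m (T.inv (b u)) (σ (Λ.symm u).1)) V :=
    Γ.smooth_m.comp (hγ.prodMk hσV) hcomp
  have hsl : ∀ u ∈ V, Γ.s (Γ.m (T.inv (b u)) (σ (Λ.symm u).1)) = x₀ := fun u hu => by
    rw [Γ.s_m _ _ (hcomp u hu), hsσ _ hu.1]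
  have htl : ∀ u ∈ V, Γ.t (Γ.m (T.inv (b u)) (σ (Λ.symm u).1)) = Γ.t (T.inv (b u)) :=
    fun u hu => Γ.t_m _ _ (hcomp u hu)
  have hex : ∀ u, ∃ p : Γ.actionGraph A.ι, u ∈ V →
      p.1.1 = T.inv (b u) ∧ p.1.2.1 = φ.symm (Λ.symm u).1 := fun u => by
    by_cases hu : u ∈ V
    · exact ⟨⟨(T.inv (b u), φ.symm (Λ.symm u).1, A.proj ⟨_, hsl u hu⟩),
        hsγ u hu, (htl u hu).symm⟩, fun _ => ⟨rfl, rfl⟩⟩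
    · exact ⟨p₀, fun h => absurd h hu⟩
  choose inv hinv using hex
  have hinv_smooth : ContMDiffOn (𝓡 n) (𝓘(ℝ, EG).prod ((𝓡 k).prod (𝓡 k))) ∞
      (fun u => (inv u).1) V := by
    have h1 : ContMDiffOn (𝓡 n) 𝓘(ℝ, EG) ∞ (fun u => (inv u).1.1) V :=
      hγ.congr fun u hu => (hinv u hu).1
    have h2 : ContMDiffOn (𝓡 n) (𝓡 k) ∞ (fun u => (inv u).1.2.1) V :=
      A.contMDiffOn_of_lift hV hσV (fun u hu => hsσ _ hu.1) fun u hu => by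
        rw [htσ _ hu.1, (hinv u hu).2]
    have h3 : ContMDiffOn (𝓡 n) (𝓡 k) ∞ (fun u => (inv u).1.2.2) V :=
      A.contMDiffOn_of_lift hV hl hsl fun u hu => by
        rw [htl u hu, ← (hinv u hu).1, (inv u).2.2]
    exact h1.prodMk (h2.prodMk h3)
  have hsource : ∀ p : Γ.actionGraph A.ι, p.1.2.1 ∈ φ.source →
      b (Λ (φ p.1.2.1, T.fib p.1.1)) = (Γ.s p.1.1, T.fib p.1.1) := fun p hp => by
    simp only [b, ContinuousLinearEquiv.symm_apply_apply, φ.left_inv hp, p.2.1]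
  have hmap : ∀ p : Γ.actionGraph A.ι, p.1.1 ∈ T.U → p.1.2.1 ∈ φ.source →
      Λ (φ p.1.2.1, T.fib p.1.1) ∈ V := fun p hpU hp => by
    refine ⟨?_, ?_⟩
    · simp only [V₁, mem_preimage, ContinuousLinearEquiv.symm_apply_apply]
      exact φ.map_source hp
    · rw [mem_preimage, hsource p hp]
      exact T.mem_W _ hpU
  let O : Set (G × A.Leaf × A.Leaf) := T.U ×ˢ φ.source ×ˢ univ
  have hO : IsOpen O := T.isOpen_U.prod (φ.open_source.prod isOpen_univ)
  let q : G × A.Leaf × A.Leaf → EuclideanSpace ℝ (Fin n) := fun p => Λ (φ p.2.1, T.fib p.1)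
  have hq : ContMDiffOn (𝓘(ℝ, EG).prod ((𝓡 k).prod (𝓡 k))) (𝓡 n) ∞ q O := by
    have h1 : ContMDiffOn (𝓘(ℝ, EG).prod ((𝓡 k).prod (𝓡 k))) (𝓡 k) ∞
        (fun p : G × A.Leaf × A.Leaf => φ p.2.1) O :=
      hφs.comp (contMDiff_fst.comp contMDiff_snd).contMDiffOn fun p hp => hp.2.1
    have h2 : ContMDiffOn (𝓘(ℝ, EG).prod ((𝓡 k).prod (𝓡 k))) (𝓡 d) ∞
        (fun p : G × A.Leaf × A.Leaf => T.fib p.1) O :=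
      T.smooth_fib.comp contMDiff_fst.contMDiffOn fun p hp => hp.1
    exact Λ.contDiff.contMDiff.comp_contMDiffOn (h1.prodMk_space h2)
  let Φ : OpenPartialHomeomorph (Γ.actionGraph A.ι) (EuclideanSpace ℝ (Fin n)) :=
    { toFun := fun p => q p.1
      invFun := inv
      source := Subtype.val ⁻¹' O
      target := V
      map_source' := fun p hp => hmap p hp.1 hp.2.1
      map_target' := fun u hu => by
        obtain ⟨h1, h2⟩ := hinv u hu
        refine ⟨?_, ?_, mem_univ _⟩
        · rw [h1]
          exact T.inv_mem _ hu.2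
        · rw [h2]
          exact φ.map_target hu.1
      left_inv' := fun p hp => by
        obtain ⟨h1, h2⟩ := hinv _ (hmap p hp.1 hp.2.1)
        rw [hsource p hp.2.1, T.inv_fib _ hp.1] at h1
        rw [ContinuousLinearEquiv.symm_apply_apply, φ.left_inv hp.2.1] at h2
        refine Subtype.ext (Prod.ext h1 (Prod.ext h2 (A.ι_injective ?_)))
        rw [← p.2.2, ← (inv (q p.1)).2.2]
        exact congrArg Γ.t h1
      right_inv' := fun u hu => by
        obtain ⟨h1, h2⟩ := hinv u hu
        simp only [q, h1, h2, φ.right_inv hu.1, T.fib_inv _ hu.2, b]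
        exact Λ.apply_symm_apply u
      open_source := hO.preimage continuous_subtype_val
      open_target := hV
      continuousOn_toFun := hq.continuousOn.comp continuous_subtype_val.continuousOn fun p hp => hp
      continuousOn_invFun := IsInducing.subtypeVal.continuousOn_iff.2 hinv_smooth.continuousOn }
  exact ⟨Φ, ⟨hT, hφ₀, mem_univ _⟩, hinv_smooth, q, O, hO, hq, fun p hp => ⟨hp, rfl⟩⟩

theorem isLagrangian_actionGraph (hΩ : Γ.IsSymplectic Ω) :
    (actionForm Ω (A.form Ω)).IsLagrangian (Γ.actionGraph A.ι) := by
  choose φ hφ h using A.exists_isSliceChart_actionGraph rfl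
  let _ := chartedSpaceOfCharts φ hφ
  have himm := isImmersion_of_isSliceChart continuous_subtype_val hφ h
  refine ⟨_, chartedSpaceOfCharts φ hφ, isManifold_of_isSliceChart hφ h,
    ⟨himm, IsEmbedding.subtypeVal⟩, ?_,
    A.pullback_actionForm hΩ himm.contMDiff Subtype.property⟩
  have := hΩ.finrank_eq x₀
  simp
  omega

end OrbitAtlas

end LieGroupoid

end

theorem mainTheorem6
    {EG : Type*} [NormedAddCommGroup EG] [NormedSpace ℝ EG] [FiniteDimensional ℝ EG]
    {EM : Type*} [NormedAddCommGroup EM] [NormedSpace ℝ EM] [FiniteDimensional ℝ EM]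
    {G : Type*} [TopologicalSpace G] [ChartedSpace EG G] [IsManifold 𝓘(ℝ, EG) ∞ G]
    [T2Space G] [SecondCountableTopology G]
    {M : Type u} [TopologicalSpace M] [ChartedSpace EM M] [IsManifold 𝓘(ℝ, EM) ∞ M]
    [T2Space M] [SecondCountableTopology M]
    (Γ : LieGroupoid 𝓘(ℝ, EG) 𝓘(ℝ, EM) G M)
    (Ω : TwoForm 𝓘(ℝ, EG) G) (hΩ : Γ.IsSymplectic Ω)
    (π : BivectorField 𝓘(ℝ, EM) M) (hπ : π.IsPoisson) (hint : Γ.Integrates Ω π)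
    (S : Set M) (hS : Γ.IsIsoClass S) :
    -- `S` is the image of an injectively immersed manifold `F` ...
    ∃ (k : ℕ) (F : Type u) (_ : TopologicalSpace F)
      (_ : ChartedSpace (EuclideanSpace ℝ (Fin k)) F) (ι : F → M),
      IsManifold (𝓡 k) ∞ F ∧ T2Space F ∧ SecondCountableTopology F ∧
      IsImmersion (𝓡 k) 𝓘(ℝ, EM) ∞ ι ∧ Function.Injective ι ∧ Set.range ι = S ∧
      -- ... which carries a unique 2-form induced by `π`; this form is symplectic,
      -- and the graph of the action is Lagrangian.
      ∃ ΩF : TwoForm (𝓡 k) F,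
        π.Induces ι ΩF ∧ (∀ ΩF' : TwoForm (𝓡 k) F, π.Induces ι ΩF' → ΩF' = ΩF) ∧
        ΩF.IsSymplectic ∧
        (actionForm Ω ΩF).IsLagrangian (Γ.actionGraph ι) := by
  obtain ⟨x₀, rfl⟩ := hS
  obtain ⟨A⟩ := hΩ.nonempty_orbitAtlas (x₀ := x₀)
  exact ⟨Γ.orbitDim x₀, A.Leaf, inferInstance, inferInstance, A.ι, inferInstance, inferInstance,
    inferInstance, A.isImmersion_ι, A.ι_injective, A.range_ι, A.form Ω, A.induces_form hΩ hint,
    fun _ h => A.eq_of_induces hΩ hint (A.induces_form hΩ hint) h, A.isSymplectic_form hΩ hint,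
    A.isLagrangian_actionGraph hΩ⟩
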